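/- Let $H_0,V$ be Hermitian $2\times2$ matrices with $[H_0,V]\ne0$ and let $W$ be a unitary $2\times 2$ matrix. For $T>0$ and a control $f\in L^1([0,T];\mathbb R)$ let $U_t$, $t\in[0,T]$, be the solution with absolutely continuous matrix elements of $$i\,\frac{dU_t}{dt}=(H_0+f(t)V)U_t\ \text{ for almost every } t,\qquad U_{0}=\mathbb I ,$$ and put $\mathcal J_W[f]=\frac14|\operatorname{Tr}(W^\dagger U_T)|^2$. Let $$f_0=\frac{-\operatorname{Tr}H_0\operatorname{Tr}V+2\operatorname{Tr}(H_0V)}{(\operatorname{Tr}V)^2-2\operatorname{Tr}V^2},\qquad d=\Bigl\|H_0+f_0V-\tfrac12\mathbb I\operatorname{Tr}H_0-\tfrac12f_0\mathbb I\operatorname{Tr}V\Bigr\|$$ with the operator norm. We say that all maxima of $\mathcal J_W$ are global (for the duration $T$) if every local maximum $f$ of $\mathcal J_W$ on $L^1([0,T];\mathbb R)$, with respect to the norm topology, is a global maximum, with the largest possible value $\mathcal J_W[f]=1$. (1) If $[H_0+f_0V,W]\ne0$, then for every $T>0$ all maxima of $\mathcal J_W$ are global. (2) If $[H_0+f_0V,W]=0$,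 then $W=e^{i\alpha_W(H_0+f_0V)+i\beta_W}$ for some $\alpha_W\in(0,\pi/d]$ and $\beta_W\in[0,2\pi)$. For any representation of $W$ in this form (with real $\alpha_W,\beta_W$): if $\alpha_W\in(0,\pi/(2d))$, then for every $T>0$ all maxima of $\mathcal J_W$ are global; if $\alpha_W\in[\pi/(2d),\pi/d]$, then for every $T>\pi/d-\alpha_W$ all maxima of $\mathcal J_W$ are global. -/

import Mathlib

open scoped Matrix

noncomputable section

namespace Qubit

/-- `2 × 2` complex matrices. -/
abbrev Mat := Matrix (Fin 2) (Fin 2) ℂ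

/-- The space of controls `L¹([0,T]; ℝ)`, with its norm topology. -/
abbrev Control (T : ℝ) : Type :=
  MeasureTheory.Lp ℝ 1 (MeasureTheory.volume.restrict (Set.Icc (0 : ℝ) T))

/-- The operator norm of a `2 × 2` matrix acting on `ℂ²` with its Euclidean norm. -/
def opNorm (A : Mat) : ℝ := ‖Matrix.toEuclideanCLM (n := Fin 2) (𝕜 := ℂ) A‖

/-- `U` solves the Schrödinger equation `i dU/dt = (H₀ + f(t) V) U`, `U 0 = 1`, on `[0,T]`: its
matrix elements are absolutely continuous on `[0,T]` and the equation holds for almost every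
`t ∈ [0,T]` (the values of `U` outside `[0,T]` are irrelevant). -/
structure IsEvolution (H₀ V : Mat) (T : ℝ) (f : ℝ → ℝ) (U : ℝ → Mat) : Prop where
  initial : U 0 = 1
  absCont : ∀ i j, AbsolutelyContinuousOnInterval (fun t => U t i j) 0 T
  equation : ∀ᵐ t ∂(MeasureTheory.volume.restrict (Set.Icc (0 : ℝ) T)),
    ∃ U' : Mat, (∀ i j, HasDerivAt (fun s => U s i j) (U' i j) t) ∧
      Complex.I • U' = (H₀ + f t • V) * U t

/-- The evolution operator `U_T` at the final time, produced by the control `f`: the value at `T`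
of the solution of the Schrödinger equation. (For `f ∈ L¹` and `T > 0` a solution exists and its
values on `[0,T]` are unique, so the choice made here does not matter.) -/
def finalEvolution (H₀ V : Mat) (T : ℝ) (f : Control T) : Mat :=
  Classical.epsilon (IsEvolution H₀ V T f) T

/-- The objective functional `J_W[f] = |Tr(W† U_T)|² / 4`. -/
def objective (H₀ V W : Mat) (T : ℝ) (f : Control T) : ℝ :=
  ‖(Wᴴ * finalEvolution H₀ V T f).trace‖ ^ 2 / 4

/-- All maxima of `J_W` on `L¹([0,T]; ℝ)` are global: every local maximum `f` is a maximum over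
the whole space of controls, and there `J_W` has its largest possible value `1`. -/
def AllMaximaGlobal (H₀ V W : Mat) (T : ℝ) : Prop :=
  ∀ f : Control T, IsLocalMax (objective H₀ V W T) f →
    (∀ g : Control T, objective H₀ V W T g ≤ objective H₀ V W T f) ∧ objective H₀ V W T f = 1

/-- The special control
`f₀ = (-Tr H₀ Tr V + 2 Tr(H₀ V)) / ((Tr V)² - 2 Tr V²)`; the traces are real for Hermitian
`H₀` and `V`. -/
def specialControl (H₀ V : Mat) : ℝ :=
  (-(H₀.trace.re * V.trace.re) + 2 * (H₀ * V).trace.re) /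
    (V.trace.re ^ 2 - 2 * (V * V).trace.re)

/-- The Hamiltonian `H₀ + f₀ V` with the special control. -/
def specialHamiltonian (H₀ V : Mat) : Mat := H₀ + specialControl H₀ V • V

/-- `d = ‖H₀ + f₀ V - 1 Tr H₀ / 2 - f₀ 1 Tr V / 2‖`. -/
def specialNorm (H₀ V : Mat) : ℝ :=
  opNorm (H₀ + specialControl H₀ V • V - (H₀.trace / 2) • (1 : Mat)
    - specialControl H₀ V • ((V.trace / 2) • (1 : Mat)))

/-- The matrix `exp(i α (H₀ + f₀ V) + i β)`. -/
def specialGate (H₀ V : Mat) (α β : ℝ) : Mat :=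
  NormedSpace.exp ((Complex.I * α) • specialHamiltonian H₀ V + (Complex.I * β) • (1 : Mat))

end Qubit

end

open scoped Matrix

namespace Qubit

open Set Filter Topology MeasureTheory Quaternion

/-! Up to a phase the problem lives in the unit quaternions. The evolution becomes $u'=(p+F'q)u$,
where $q$ is the unit imaginary quaternion of $V$, $p$ (`drift`) comes from the traceless part of
$H_0+f_0V$, and $F'=\|\mathrm{axis}\,V\|\,(f-f_0)$. The value $f_0$ is the one that makes $p$
orthogonal to $q$ (`axisPair`). In the interaction picture $u=e^{Fq}s$ the flow $s$ moves with the
fixed speed $\|p\|$, whatever the control. If $W$ is a phase times $\omega$, the objective is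
$(\operatorname{Re}y)^2$ with $y=\bar\omega u_T$ (`objective_eq`).

A bump of small area is small in $L^1$ however narrow it is, so a local maximum can be tested
against ideal impulses $e^{\varepsilon q}$ at chosen times (`exists_impulseMaximal`,
`abs_re_impulse_le`). An impulse at time $\tau$ replaces $y$ by $ye^{\varepsilon Q_\tau}$ with
$Q_\tau=\bar s_\tau q s_\tau$.

A single impulse gives $\operatorname{Re}(yQ_\tau)=0$ for all $\tau$. If $y$ is not real,
differentiating in $\tau$ shows that the imaginary part of $y$, carried along by $s$, stays parallel
to the drift and hence constant; this forces $F=0$, that is $f=f_0$, and $\omega$ commutes with $p$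
(`IsFlow.eq_zero_of_orthogonal`). If $y$ is real, the objective is already $1$. This proves (1).

Two impulses give $|\operatorname{Re}(yQ_2Q_1)|\le|\operatorname{Re}y|$. At $f_0$ this reads
$|\cos(\theta-2x)|\le|\cos\theta|$ for $0<x<dT$, where $\theta=(\alpha_W+T)d$. By `exists_cos_sq_lt`
it fails in the ranges of (2) unless $\sin\theta=0$, and then the objective is $1$ as well. -/

/-! ### Imaginary quaternions and rotations -/

/-- `p` and `q` are orthogonal imaginary quaternions, `p ≠ 0` and `q` is a unit. -/
structure AxisPair (p q : ℍ[ℝ]) : Prop where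
  star_left : star p = -p
  star_right : star q = -q
  anticomm : q * p = -(p * q)
  sq_right : q * q = -1
  left_ne_zero : p ≠ 0

/-- The quaternion `cos x + sin x q`. -/
noncomputable def rot (q : ℍ[ℝ]) (x : ℝ) : ℍ[ℝ] := Real.cos x • (1 : ℍ[ℝ]) + Real.sin x • q

lemma rot_zero (q : ℍ[ℝ]) : rot q 0 = 1 := by simp [rot]

lemma rot_add {q : ℍ[ℝ]} (hq : q * q = -1) (x y : ℝ) : rot q (x + y) = rot q x * rot q y := by
  simp only [rot, Real.cos_add, Real.sin_add, mul_add, add_mul, smul_mul_assoc, mul_smul_comm,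
    one_mul, mul_one, hq]
  module

lemma star_rot {q : ℍ[ℝ]} (hq : star q = -q) (x : ℝ) : star (rot q x) = rot q (-x) := by
  simp [rot, hq]

lemma mul_rot {p q : ℍ[ℝ]} (h : q * p = -(p * q)) (x : ℝ) :
    rot q x * p = p * rot q (-x) := by
  simp [rot, add_mul, mul_add, h]

lemma hasDerivAt_rot {q : ℍ[ℝ]} (hq : q * q = -1) (x : ℝ) :
    HasDerivAt (rot q) (q * rot q x) x := by
  have h := ((Real.hasDerivAt_cos x).smul_const (1 : ℍ[ℝ])).add
    ((Real.hasDerivAt_sin x).smul_const q)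
  refine h.congr_deriv ?_
  simp only [rot, mul_add, mul_smul_comm, mul_one, hq]
  module

lemma continuous_rot (q : ℍ[ℝ]) : Continuous (rot q) := by
  unfold rot; fun_prop

lemma norm_eq_one_of_star_mul_self {x : ℍ[ℝ]} (h : star x * x = 1) : ‖x‖ = 1 := by
  have h1 : ‖star x * x‖ = 1 := by rw [h, norm_one]
  rw [norm_mul, Quaternion.norm_star] at h1
  nlinarith [norm_nonneg x]

lemma mul_star_self_of_star_mul_self {x : ℍ[ℝ]} (h : star x * x = 1) : x * star x = 1 := by
  rwa [Quaternion.self_mul_star, ← Quaternion.star_mul_self]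

lemma star_mul_self_of_norm {x : ℍ[ℝ]} (h : ‖x‖ = 1) : star x * x = 1 := by
  rw [Quaternion.star_mul_self, Quaternion.normSq_eq_norm_mul_self, h]; simp

lemma star_mul_self_rot {q : ℍ[ℝ]} (hs : star q = -q) (hq : q * q = -1) (x : ℝ) :
    star (rot q x) * rot q x = 1 := by
  rw [star_rot hs, ← rot_add hq, neg_add_cancel, rot_zero]

lemma norm_rot {q : ℍ[ℝ]} (hs : star q = -q) (hq : q * q = -1) (x : ℝ) : ‖rot q x‖ = 1 :=
  norm_eq_one_of_star_mul_self (star_mul_self_rot hs hq x)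

lemma re_mul_comm (a b : ℍ[ℝ]) : (a * b).re = (b * a).re := by
  simp only [Quaternion.re_mul]; ring

lemma re_eq_zero_of_star {a : ℍ[ℝ]} (h : star a = -a) : a.re = 0 := by
  have := congrArg QuaternionAlgebra.re h
  simp at this
  linarith

lemma abs_re_le_norm (a : ℍ[ℝ]) : |a.re| ≤ ‖a‖ := by
  have h := Quaternion.normSq_eq_norm_mul_self a
  rw [Quaternion.normSq_def'] at h
  apply abs_le_of_sq_le_sq _ (norm_nonneg a)
  nlinarith [sq_nonneg a.imI, sq_nonneg a.imJ, sq_nonneg a.imK]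

lemma add_star_eq (a : ℍ[ℝ]) : a + star a = (2 * a.re) • (1 : ℍ[ℝ]) := by
  ext <;> simp
  ring

/-- For imaginary factors `b * a` is the conjugate of `a * b`, so $ab+ba=2\operatorname{Re}(ab)$.
This turns orthogonality into an algebraic identity. -/
lemma anticomm_of_re_mul_eq_zero {a b : ℍ[ℝ]} (ha : star a = -a) (hb : star b = -b)
    (h : (a * b).re = 0) : a * b = -(b * a) := by
  have := add_star_eq (a * b)
  rw [star_mul, ha, hb, h, neg_mul_neg] at this
  simpa [add_eq_zero_iff_eq_neg] using this

/-- An imaginary quaternion orthogonal to `q` and `q p` is parallel to `p`. -/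
lemma commute_of_re_mul_eq_zero {p q z : ℍ[ℝ]} (h : AxisPair p q) (hz : star z = -z)
    (h₁ : (z * q).re = 0) (h₂ : (z * (q * p)).re = 0) : z * p = p * z := by
  have e₁ := anticomm_of_re_mul_eq_zero hz h.star_right h₁
  have hzq : star (z * q) = -(z * q) := by
    rw [star_mul, hz, h.star_right, neg_mul_neg, e₁, neg_neg]
  have e₂ := anticomm_of_re_mul_eq_zero hzq h.star_left (by rw [mul_assoc]; exact h₂)
  have e₃ : z * p * q = p * z * q := by
    have : z * q * p = -(z * p * q) := by rw [mul_assoc, h.anticomm]; simp [mul_assoc]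
    rw [this] at e₂
    simpa [mul_assoc] using e₂
  have hq : q ≠ 0 := by rintro rfl; simpa using h.sq_right
  exact mul_right_cancel₀ hq e₃

/-- Conjugation by a rotation about `q` turns the drift within the plane orthogonal to `q`. Hence
the interaction-picture generator has the properties of the original drift at every time. -/
lemma AxisPair.mul_rot {p q : ℍ[ℝ]} (h : AxisPair p q) (x : ℝ) : AxisPair (p * rot q x) q where
  star_left := by
    rw [star_mul, star_rot h.star_right, h.star_left, mul_neg, Qubit.mul_rot h.anticomm, neg_neg]
  star_right := h.star_right
  anticomm := by
    have : q * rot q x = rot q x * q := by simp [rot, mul_add, add_mul]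
    rw [← mul_assoc, h.anticomm, neg_mul, mul_assoc, this, mul_assoc]
  sq_right := h.sq_right
  left_ne_zero := by
    refine mul_ne_zero h.left_ne_zero fun h0 => ?_
    simpa [h0] using norm_rot h.star_right h.sq_right x

/-! ### The evolution in the interaction picture -/

/-- `s` solves `s' = p e^{2 F q} s`, `s 0 = 1` on `[0, T]`: this is the evolution equation
`u' = (p + F' q) u` for `u = e^{F q} s`. -/
structure IsFlow (p q : ℍ[ℝ]) (T : ℝ) (F : ℝ → ℝ) (s : ℝ → ℍ[ℝ]) : Prop where
  initial : s 0 = 1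
  hasDerivAt : ∀ t ∈ Icc 0 T, HasDerivAt s (p * rot q (2 * F t) * s t) t

lemma hasDerivAt_star {s : ℝ → ℍ[ℝ]} {s' : ℍ[ℝ]} {t : ℝ} (h : HasDerivAt s s' t) :
    HasDerivAt (fun x => star (s x)) (star s') t := by
  have : StarModule ℝ ℍ[ℝ] := ⟨fun r x => by ext <;> simp⟩
  exact h.star

lemma eq_of_hasDerivAt_zero {E : Type*} [NormedAddCommGroup E] [NormedSpace ℝ E] {g : ℝ → E}
    {a b : ℝ} (h : ∀ t ∈ Icc a b, HasDerivAt g 0 t) : ∀ t ∈ Icc a b, g t = g a :=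
  constant_of_has_deriv_right_zero
    (fun t ht => (h t ht).continuousAt.continuousWithinAt)
    (fun t ht => (h t (Ico_subset_Icc_self ht)).hasDerivWithinAt)

section Flow

variable {p q : ℍ[ℝ]} {T : ℝ} {F E : ℝ → ℝ} {s σ : ℝ → ℍ[ℝ]}

lemma IsFlow.star_mul_self (h : AxisPair p q) (hs : IsFlow p q T F s) {t : ℝ}
    (ht : t ∈ Icc 0 T) : star (s t) * s t = 1 := by
  have hd : ∀ t ∈ Icc 0 T, HasDerivAt (fun t => star (s t) * s t) 0 t := fun t ht => by
    refine ((hasDerivAt_star (hs.hasDerivAt t ht)).mul (hs.hasDerivAt t ht)).congr_deriv ?_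
    rw [star_mul, (h.mul_rot _).star_left]
    simp [mul_assoc]
  rw [eq_of_hasDerivAt_zero hd t ht, hs.initial]
  simp

lemma IsFlow.norm_eq_one (h : AxisPair p q) (hs : IsFlow p q T F s) {t : ℝ}
    (ht : t ∈ Icc 0 T) : ‖s t‖ = 1 :=
  norm_eq_one_of_star_mul_self (hs.star_mul_self h ht)

/-- The generator has norm `‖p‖` independently of `F`, so the flow hardly moves during a short
impulse of any height. -/
lemma IsFlow.norm_sub_le (h : AxisPair p q) (hs : IsFlow p q T F s) {a b : ℝ}
    (ha : a ∈ Icc 0 T) (hb : b ∈ Icc 0 T) : ‖s b - s a‖ ≤ ‖p‖ * |b - a| := by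
  refine (convex_Icc 0 T).norm_image_sub_le_of_norm_hasDerivWithin_le
    (fun t ht => (hs.hasDerivAt t ht).hasDerivWithinAt) (fun t ht => ?_) ha hb
  rw [norm_mul, norm_mul, norm_rot h.star_right h.sq_right, hs.norm_eq_one h ht]
  simp

lemma contDiff_inv_one_add_norm_sq_smul {E : Type*} [NormedAddCommGroup E]
    [InnerProductSpace ℝ E] :
    ContDiff ℝ 1 fun x : E => (2 * (1 + ‖x‖ ^ 2)⁻¹) • x := by
  have h : ContDiff ℝ 1 fun x : E => (1 + ‖x‖ ^ 2)⁻¹ :=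
    (contDiff_const.add (contDiff_norm_sq ℝ)).inv fun x => by positivity
  exact (contDiff_const.mul h).smul contDiff_id

/-- Picard–Lindelöf is applied to a bounded modification of the linear field:
$\varphi(x)=2x/(1+\|x\|^2)$ has norm at most $1$ and equals $x$ on the unit sphere. The generator is
imaginary, so the solution stays on the sphere and solves the original equation. -/
lemma exists_isFlow (h : AxisPair p q) (hT : 0 ≤ T) (hF : Continuous F) :
    ∃ s, IsFlow p q T F s := by
  set φ : ℍ[ℝ] → ℍ[ℝ] := fun x => (2 * (1 + ‖x‖ ^ 2)⁻¹) • x with hφ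
  have hφ1 : ∀ x, ‖φ x‖ ≤ 1 := fun x => by
    rw [hφ]
    simp only [norm_smul]
    rw [Real.norm_of_nonneg (by positivity), mul_assoc, ← div_eq_inv_mul, ← mul_div_assoc,
      div_le_one (by positivity)]
    nlinarith [sq_nonneg (‖x‖ - 1)]
  have hnorm : ∀ t x, ‖p * rot q (2 * F t) * x‖ = ‖p‖ * ‖x‖ := fun t x => by
    rw [norm_mul, norm_mul, norm_rot h.star_right h.sq_right, mul_one]
  -- The time interval is enlarged to $[-1,T+1]$ to get two-sided derivatives on $[0,T]$. At speed
  -- at most `‖p‖` the solution stays within this radius of its initial value.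
  let a : NNReal := ⟨‖p‖ * (T + 1), by positivity⟩
  obtain ⟨K, hK⟩ := (contDiff_inv_one_add_norm_sq_smul (E := ℍ[ℝ])).contDiffOn
    |>.exists_lipschitzOnWith (s := Metric.closedBall (1 : ℍ[ℝ]) a) one_ne_zero
      (convex_closedBall _ _) (isCompact_closedBall _ _)
  have hPL : IsPicardLindelof (fun t x => p * rot q (2 * F t) * φ x)
      (tmin := -1) (tmax := T + 1) ⟨0, by constructor <;> linarith⟩ (1 : ℍ[ℝ]) a 0 ‖p‖₊
      (‖p‖₊ * K) := by
    refine ⟨fun t _ => ?_, fun x _ => ?_, fun t _ x _ => ?_, ?_⟩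
    · refine LipschitzOnWith.of_dist_le_mul fun x hx y hy => ?_
      rw [dist_eq_norm, ← mul_sub, hnorm, NNReal.coe_mul, mul_assoc]
      gcongr
      · exact le_rfl
      · rw [← dist_eq_norm]; exact hK.dist_le_mul x hx y hy
    · have := continuous_rot q
      fun_prop
    · rw [hnorm]
      exact mul_le_of_le_one_right (norm_nonneg _) (hφ1 x)
    · simp only [sub_zero, zero_sub, neg_neg]
      rw [max_eq_left (by linarith)]
      rw [NNReal.coe_zero, sub_zero]
      exact le_rfl
  obtain ⟨s, hs0, hs⟩ := hPL.exists_eq_forall_mem_Icc_hasDerivWithinAt₀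
  have hd : ∀ t ∈ Icc 0 T, HasDerivAt s (p * rot q (2 * F t) * φ (s t)) t := fun t ht =>
    (hs t ⟨by linarith [ht.1], by linarith [ht.2]⟩).hasDerivAt
      (Icc_mem_nhds (by linarith [ht.1]) (by linarith [ht.2]))
  have h1 : ∀ t ∈ Icc 0 T, ‖s t‖ = 1 := fun t ht => by
    have hd' : ∀ t ∈ Icc 0 T, HasDerivAt (fun t => star (s t) * s t) 0 t := fun t ht => by
      refine ((hasDerivAt_star (hd t ht)).mul (hd t ht)).congr_deriv ?_
      rw [star_mul, (h.mul_rot _).star_left]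
      simp [hφ, mul_assoc]
    apply norm_eq_one_of_star_mul_self
    rw [eq_of_hasDerivAt_zero hd' t ht, hs0]
    simp
  refine ⟨s, hs0, fun t ht => ?_⟩
  have h2 := hd t ht
  have : φ (s t) = s t := by
    simp only [hφ, h1 t ht]; norm_num
  rwa [this] at h2

/-- The flow for `F`, corrected so as to be compared with the flow for `E`. -/
lemma IsFlow.relative_eq (h : AxisPair p q) (hs : IsFlow p q T F s) (hσ : IsFlow p q T E σ)
    {a b c : ℝ} (ha : 0 ≤ a) (hab : a ≤ b) (hb : b ≤ T) (hc : ∀ t ∈ Icc a b, E t = F t + c) :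
    star (s b) * rot q c * σ b = star (s a) * rot q c * σ a := by
  have hd : ∀ t ∈ Icc a b, HasDerivAt (fun t => star (s t) * rot q c * σ t) 0 t := fun t ht => by
    have ht' : t ∈ Icc 0 T := ⟨ha.trans ht.1, ht.2.trans hb⟩
    refine (((hasDerivAt_star (hs.hasDerivAt t ht')).mul_const (rot q c)).mul
      (hσ.hasDerivAt t ht')).congr_deriv ?_
    have e : rot q c * (p * rot q (2 * E t)) = p * rot q (2 * F t) * rot q c := by
      rw [← mul_assoc, Qubit.mul_rot h.anticomm, mul_assoc, mul_assoc, ← rot_add h.sq_right,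
        ← rot_add h.sq_right, hc t ht]
      ring_nf
    rw [star_mul, (h.mul_rot _).star_left, mul_assoc (star (s t)) (rot q c), ← mul_assoc (rot q c),
      e]
    simp [mul_assoc]
  exact eq_of_hasDerivAt_zero hd b ⟨hab, le_rfl⟩

/-- Nothing is assumed about `E` between `a` and `b`: both flows are Lipschitz with constant `‖p‖`.
The additional rotation by `ε` about `q`, moved to the left of the product, becomes a rotation about
the transported axis. -/
lemma IsFlow.norm_relative_sub_le (h : AxisPair p q) (hs : IsFlow p q T F s)
    (hσ : IsFlow p q T E σ) {a b c ε : ℝ} (ha : a ∈ Icc 0 T) (hb : b ∈ Icc 0 T) :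
    ‖star (s b) * rot q (c + ε) * σ b
      - rot (star (s a) * q * s a) ε * (star (s a) * rot q c * σ a)‖ ≤ 2 * ‖p‖ * |b - a| := by
  have e : rot (star (s a) * q * s a) ε * (star (s a) * rot q c * σ a)
      = star (s a) * rot q (c + ε) * σ a := by
    have : rot (star (s a) * q * s a) ε = star (s a) * rot q ε * s a := by
      simp [rot, mul_add, add_mul, hs.star_mul_self h ha]
    rw [this, add_comm c, rot_add h.sq_right]
    have := mul_star_self_of_star_mul_self (hs.star_mul_self h ha)
    calc _ = star (s a) * rot q ε * (s a * star (s a)) * rot q c * σ a := by simp only [mul_assoc]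
      _ = _ := by rw [this]; simp only [mul_assoc, one_mul]
  rw [e]
  have e2 : star (s b) * rot q (c + ε) * σ b - star (s a) * rot q (c + ε) * σ a
      = star (s b - s a) * rot q (c + ε) * σ b + star (s a) * rot q (c + ε) * (σ b - σ a) := by
    rw [star_sub]; noncomm_ring
  rw [e2]
  refine (norm_add_le _ _).trans ?_
  simp only [norm_mul, Quaternion.norm_star, norm_rot h.star_right h.sq_right,
    hs.norm_eq_one h ha, hσ.norm_eq_one h hb, mul_one, one_mul]
  linarith [hs.norm_sub_le h ha hb, hσ.norm_sub_le h ha hb]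

/-! ### Impulsive variations -/

/-- The control direction `q` at time `t`, transported to time `0` along the flow `s`. -/
noncomputable def transport (q : ℍ[ℝ]) (s : ℝ → ℍ[ℝ]) (t : ℝ) : ℍ[ℝ] := star (s t) * q * s t

lemma star_transport (hq : star q = -q) (t : ℝ) : star (transport q s t) = -transport q s t := by
  simp [transport, hq, mul_assoc]

lemma IsFlow.transport_mul_self (h : AxisPair p q) (hs : IsFlow p q T F s) {t : ℝ}
    (ht : t ∈ Icc 0 T) : transport q s t * transport q s t = -1 := by
  have e := mul_star_self_of_star_mul_self (hs.star_mul_self h ht)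
  calc _ = star (s t) * q * (s t * star (s t)) * q * s t := by simp only [transport, mul_assoc]
    _ = star (s t) * (q * q) * s t := by rw [e]; simp only [mul_assoc, one_mul]
    _ = _ := by rw [h.sq_right, mul_neg_one, neg_mul, hs.star_mul_self h ht]

/-- If the final values reached by smeared impulses of strengths `ε₁`, `ε₂` at times `τ₁ < τ₂`
satisfy a bound, then so does the value reached by the ideal impulses. -/
lemma abs_re_impulse_le (h : AxisPair p q) (hs : IsFlow p q T F s) {ω : ℍ[ℝ]} (hω : ‖ω‖ = 1)
    {τ₁ τ₂ ε₁ ε₂ A : ℝ} (h₁ : 0 < τ₁) (h₁₂ : τ₁ < τ₂) (h₂ : τ₂ < T)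
    (hη : ∀ η > 0, τ₁ + η ≤ τ₂ → τ₂ + η ≤ T → ∃ E σ, IsFlow p q T E σ ∧
      (∀ t ∈ Icc 0 τ₁, E t = F t) ∧ (∀ t ∈ Icc (τ₁ + η) τ₂, E t = F t + ε₁) ∧
      (∀ t ∈ Icc (τ₂ + η) T, E t = F t + (ε₁ + ε₂)) ∧
      |(star ω * (rot q (E T) * σ T)).re| ≤ A) :
    |(star ω * (rot q (F T) * s T) *
      (rot (transport q s τ₂) ε₂ * rot (transport q s τ₁) ε₁)).re| ≤ A := by
  refine le_of_forall_pos_le_add fun e he => ?_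
  have hp0 := norm_nonneg p
  -- The first two bounds keep the impulses disjoint and inside $[0,T]$; the third makes the total
  -- smearing error $4\|p\|\eta$ at most `e`.
  set η := min (min (τ₂ - τ₁) (T - τ₂)) (e / (4 * ‖p‖ + 1)) with hηdef
  have hη0 : 0 < η := lt_min (lt_min (by linarith) (by linarith)) (by positivity)
  have hη1 : τ₁ + η ≤ τ₂ := by
    linarith [(min_le_left _ _).trans (min_le_left _ _) |>.trans_eq' hηdef]
  have hη2 : τ₂ + η ≤ T := by
    linarith [(min_le_left _ _).trans (min_le_right _ _) |>.trans_eq' hηdef]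
  have hη3 : 4 * ‖p‖ * η ≤ e := by
    have : η ≤ e / (4 * ‖p‖ + 1) := min_le_right _ _
    rw [le_div_iff₀ (by positivity)] at this
    nlinarith
  obtain ⟨E, σ, hσ, hE0, hE1, hE2, hA⟩ := hη η hη0 hη1 hη2
  have m0 : (0 : ℝ) ∈ Icc 0 T := ⟨le_rfl, by linarith⟩
  have mT : T ∈ Icc 0 T := ⟨by linarith, le_rfl⟩
  have m1 : τ₁ ∈ Icc 0 T := ⟨by linarith, by linarith⟩
  have m1' : τ₁ + η ∈ Icc 0 T := ⟨by linarith, by linarith⟩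
  have m2 : τ₂ ∈ Icc 0 T := ⟨by linarith, by linarith⟩
  have m2' : τ₂ + η ∈ Icc 0 T := ⟨by linarith, by linarith⟩
  set Q₁ := transport q s τ₁
  set Q₂ := transport q s τ₂
  -- The relative evolution is constant where `E - F` is constant, and it jumps, up to $2\|p\|\eta$,
  -- by a transported rotation at each impulse.
  have r0 : star (s τ₁) * rot q 0 * σ τ₁ = 1 := by
    rw [hs.relative_eq h hσ le_rfl h₁.le m1.2 (c := 0) (fun t ht => by rw [hE0 t ht, add_zero]),
      hs.initial, hσ.initial, rot_zero]
    simp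
  have r1 : star (s τ₂) * rot q ε₁ * σ τ₂ = star (s (τ₁ + η)) * rot q ε₁ * σ (τ₁ + η) :=
    hs.relative_eq h hσ (by linarith) hη1 h₂.le hE1
  have r2 : star (s T) * rot q (ε₁ + ε₂) * σ T
      = star (s (τ₂ + η)) * rot q (ε₁ + ε₂) * σ (τ₂ + η) :=
    hs.relative_eq h hσ (by linarith) hη2 le_rfl hE2
  have j1 := hs.norm_relative_sub_le h hσ (c := 0) (ε := ε₁) m1 m1'
  have j2 := hs.norm_relative_sub_le h hσ (c := ε₁) (ε := ε₂) m2 m2'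
  rw [r0, zero_add, ← r1, mul_one] at j1
  rw [← r2] at j2
  change ‖_ - rot Q₁ ε₁‖ ≤ _ at j1
  change ‖_ - rot Q₂ ε₂ * _‖ ≤ _ at j2
  rw [add_sub_cancel_left, abs_of_pos hη0] at j1 j2
  set R := star (s T) * rot q (ε₁ + ε₂) * σ T
  set R₁ := star (s τ₂) * rot q ε₁ * σ τ₂
  have hQ₂ : ‖rot Q₂ ε₂‖ = 1 :=
    norm_rot (star_transport h.star_right _) (hs.transport_mul_self h m2) _
  have hR : ‖R - rot Q₂ ε₂ * rot Q₁ ε₁‖ ≤ 4 * ‖p‖ * η := by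
    have : R - rot Q₂ ε₂ * rot Q₁ ε₁ = (R - rot Q₂ ε₂ * R₁) + rot Q₂ ε₂ * (R₁ - rot Q₁ ε₁) := by
      noncomm_ring
    rw [this]
    refine (norm_add_le _ _).trans ?_
    rw [norm_mul, hQ₂, one_mul]
    linarith
  set y := star ω * (rot q (F T) * s T)
  have hy : ‖y‖ = 1 := by
    simp only [y, norm_mul, Quaternion.norm_star, hω, norm_rot h.star_right h.sq_right,
      hs.norm_eq_one h mT, mul_one]
  have hyR : star ω * (rot q (E T) * σ T) = y * R := by
    have e1 := mul_star_self_of_star_mul_self (hs.star_mul_self h mT)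
    have e2 : E T = F T + (ε₁ + ε₂) := hE2 T ⟨hη2, le_rfl⟩
    calc _ = star ω * (rot q (F T) * ((s T * star (s T)) * (rot q (ε₁ + ε₂) * σ T))) := by
          rw [e1, e2, rot_add h.sq_right (F T), one_mul]; simp only [mul_assoc]
      _ = _ := by simp only [y, R, mul_assoc]
  rw [hyR] at hA
  have hd : |(y * (R - rot Q₂ ε₂ * rot Q₁ ε₁)).re| ≤ 4 * ‖p‖ * η := by
    refine (abs_re_le_norm _).trans ?_
    rwa [norm_mul, hy, one_mul]
  rw [mul_sub, Quaternion.re_sub] at hd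
  have := abs_sub_abs_le_abs_sub (y * (rot Q₂ ε₂ * rot Q₁ ε₁)).re (y * R).re
  rw [abs_sub_comm] at this
  linarith

/-- The square has derivative $2Ac$ at its local maximum $0$. If $A=0$ this is empty, but then the
bound itself says $\sin\varepsilon\cdot c=0$ for small $\varepsilon>0$. -/
lemma eq_zero_of_abs_cos_add_sin_le {A c δ : ℝ} (hδ : 0 < δ)
    (h : ∀ ε, |ε| < δ → |Real.cos ε * A + Real.sin ε * c| ≤ |A|) : c = 0 := by
  have hmax : IsLocalMax (fun ε => (Real.cos ε * A + Real.sin ε * c) ^ 2) 0 := by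
    filter_upwards [Metric.ball_mem_nhds (0 : ℝ) hδ] with ε hε
    simpa using sq_le_sq.2 (h ε (by simpa using hε))
  have hder : HasDerivAt (fun ε => (Real.cos ε * A + Real.sin ε * c) ^ 2) (2 * A * c) 0 := by
    refine ((((Real.hasDerivAt_cos 0).mul_const A).add
      ((Real.hasDerivAt_sin 0).mul_const c)).pow 2).congr_deriv ?_
    simp
  have h0 := hmax.hasDerivAt_eq_zero hder
  rcases mul_eq_zero.1 h0 with hA | hc
  · have hA : A = 0 := by linarith
    set ε := min (δ / 2) 1
    have e0 : 0 < ε := lt_min (by linarith) one_pos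
    have e1 : ε < δ := (min_le_left _ _).trans_lt (by linarith)
    have hsin : 0 < Real.sin ε := Real.sin_pos_of_pos_of_le_one e0 (min_le_right _ _)
    have := h ε (by rwa [abs_of_pos e0])
    simp only [hA, mul_zero, zero_add, abs_zero, abs_nonpos_iff, mul_eq_zero, hsin.ne',
      false_or] at this
    exact this
  · exact hc

lemma re_mul_rot (y Q : ℍ[ℝ]) (ε : ℝ) :
    (y * rot Q ε).re = Real.cos ε * y.re + Real.sin ε * (y * Q).re := by
  simp only [rot, mul_add, mul_smul_comm, mul_one, Quaternion.re_add, Quaternion.re_smul,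
    smul_eq_mul]

/-- Once the first-order terms vanish, impulses $\pm\varepsilon,\varepsilon$ give
$(1-\sin^2\varepsilon)A\pm\sin^2\varepsilon\,\kappa$. Bounding both by $|A|$ yields
$|\kappa|\le|A|$. -/
lemma abs_re_mul_mul_le {y Q₁ Q₂ : ℍ[ℝ]} {δ : ℝ} (hδ : 0 < δ)
    (h₁ : (y * Q₁).re = 0) (h₂ : (y * Q₂).re = 0)
    (h : ∀ ε₁ ε₂, |ε₁| + |ε₂| < δ → |(y * (rot Q₂ ε₂ * rot Q₁ ε₁)).re| ≤ |y.re|) :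
    |(y * (Q₂ * Q₁)).re| ≤ |y.re| := by
  have key : ∀ ε₁ ε₂, (y * (rot Q₂ ε₂ * rot Q₁ ε₁)).re
      = Real.cos ε₂ * Real.cos ε₁ * y.re + Real.sin ε₂ * Real.sin ε₁ * (y * (Q₂ * Q₁)).re := by
    intro ε₁ ε₂
    have : y * (rot Q₂ ε₂ * rot Q₁ ε₁) = (Real.cos ε₂ * Real.cos ε₁) • y
        + (Real.sin ε₂ * Real.cos ε₁) • (y * Q₂) + (Real.cos ε₂ * Real.sin ε₁) • (y * Q₁)
        + (Real.sin ε₂ * Real.sin ε₁) • (y * (Q₂ * Q₁)) := by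
      simp only [rot, mul_add, add_mul, mul_smul_comm, smul_mul_assoc, one_mul, mul_one]
      module
    rw [this]
    simp [h₁, h₂]
  set ε := min (δ / 3) 1
  have e0 : 0 < ε := lt_min (by linarith) one_pos
  have e1 : ε ≤ δ / 3 := min_le_left _ _
  have hsin : 0 < Real.sin ε := Real.sin_pos_of_pos_of_le_one e0 (min_le_right _ _)
  have i1 := h ε ε (by rw [abs_of_pos e0]; linarith)
  have i2 := h (-ε) ε (by rw [abs_neg, abs_of_pos e0]; linarith)
  rw [key] at i1 i2
  simp only [Real.cos_neg, Real.sin_neg] at i2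
  have hcs := Real.sin_sq_add_cos_sq ε
  have hs2 : 0 < Real.sin ε ^ 2 := by positivity
  rw [abs_le] at i1 i2 ⊢
  have hA := abs_cases y.re
  set κ := (y * (Q₂ * Q₁)).re
  have hc : Real.cos ε * Real.cos ε = 1 - Real.sin ε ^ 2 := by linarith
  have e3 : Real.sin ε * Real.sin ε = Real.sin ε ^ 2 := by ring
  have e4 : Real.sin ε * -Real.sin ε = -Real.sin ε ^ 2 := by ring
  rw [hc, e3] at i1
  rw [hc, e4] at i2
  constructor <;> refine le_of_mul_le_mul_left ?_ hs2 <;>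
    rcases hA with ⟨ha, _⟩ | ⟨ha, _⟩ <;> rw [ha] at i1 i2 ⊢ <;> linarith

/-! ### Rigidity of singular controls -/

lemma hasDerivAt_re {g : ℝ → ℍ[ℝ]} {g' : ℍ[ℝ]} {t : ℝ} (h : HasDerivAt g g' t) :
    HasDerivAt (fun x => (g x).re) g'.re t := by
  have := h.inner ℝ (hasDerivAt_const t (1 : ℍ[ℝ]))
  simpa [Quaternion.inner_def] using this

/-- A continuous function with values in the discrete set $\frac\pi2\mathbb Z$ is constant. Values
are clipped at $\pm1$ because $0<2|F|\le2<\pi$ already gives a nonzero sine. -/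
lemma eq_zero_of_sin_two_mul_eq_zero (hF : Continuous F) (hF0 : F 0 = 0)
    (h : ∀ t ∈ Icc 0 T, Real.sin (2 * F t) = 0) : ∀ t ∈ Icc 0 T, F t = 0 := by
  intro t ht
  by_contra hne
  have hsub := intermediate_value_uIcc (a := 0) (b := t) hF.continuousOn
  rw [hF0] at hsub
  have hpi := Real.pi_gt_three
  rcases lt_or_gt_of_ne hne with hlt | hgt
  · obtain ⟨x, hx, hFx⟩ := hsub (show max (F t) (-1) ∈ uIcc 0 (F t) by
      rw [uIcc_of_ge hlt.le]; exact ⟨le_max_left _ _, max_le hlt.le (by norm_num)⟩)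
    rw [uIcc_of_le ht.1] at hx
    have := h x ⟨hx.1, hx.2.trans ht.2⟩
    rw [hFx] at this
    have h1 : max (F t) (-1) < 0 := max_lt hlt (by norm_num)
    exact (Real.sin_neg_of_neg_of_neg_pi_lt (by linarith)
      (by linarith [le_max_right (F t) (-1)])).ne this
  · obtain ⟨x, hx, hFx⟩ := hsub (show min (F t) 1 ∈ uIcc 0 (F t) by
      rw [uIcc_of_le hgt.le]; exact ⟨le_min hgt.le (by norm_num), min_le_left _ _⟩)
    rw [uIcc_of_le ht.1] at hx
    have := h x ⟨hx.1, hx.2.trans ht.2⟩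
    rw [hFx] at this
    have h1 : 0 < min (F t) 1 := lt_min hgt (by norm_num)
    exact (Real.sin_pos_of_pos_of_lt_pi (by linarith)
      (by linarith [min_le_right (F t) 1])).ne' this

/-- If a non-real `y` is orthogonal to all transported control directions, the control vanishes
and `y` commutes with the drift. -/
lemma IsFlow.eq_zero_of_orthogonal (h : AxisPair p q) (hs : IsFlow p q T F s) (hT : 0 < T)
    (hF : Continuous F) (hF0 : F 0 = 0) {y : ℍ[ℝ]}
    (hy : ∀ τ ∈ Ioo 0 T, (y * transport q s τ).re = 0) (hne : y.im ≠ 0) :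
    (∀ t ∈ Icc 0 T, F t = 0) ∧ y * p = p * y := by
  set w := y.im with hw
  have hstar : star w = -w := by simp [hw]
  have hyw : y = (y.re : ℍ[ℝ]) + w := (Quaternion.re_add_im y).symm
  set P : ℝ → ℍ[ℝ] := fun t => p * rot q (2 * F t)
  have hP : ∀ t, AxisPair (P t) q := fun t => h.mul_rot _
  have hsd : ∀ t ∈ Icc 0 T, HasDerivAt s (P t * s t) t := hs.hasDerivAt
  -- The real part of `y` does not contribute, since the transported directions are imaginary.
  have hwQ : ∀ τ ∈ Ioo 0 T, (w * (star (s τ) * q * s τ)).re = 0 := fun τ hτ => by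
    have h1 := hy τ hτ
    have h2 : (transport q s τ).re = 0 := re_eq_zero_of_star (star_transport h.star_right τ)
    rw [hyw, add_mul, Quaternion.re_add, Quaternion.coe_mul_eq_smul, Quaternion.re_smul, h2,
      smul_zero, zero_add] at h1
    exact h1
  -- Differentiating the orthogonality relation in `τ` gives orthogonality to a second direction.
  have hwQ' : ∀ τ ∈ Ioo 0 T, (w * (star (s τ) * (q * P τ) * s τ)).re = 0 := fun τ hτ => by
    have hτ' := Ioo_subset_Icc_self hτ
    have hd := hasDerivAt_re (((hasDerivAt_star (hsd τ hτ')).mul_const q).mul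
      (hsd τ hτ') |>.const_mul w)
    have h0 : HasDerivAt (fun t => (w * (star (s t) * q * s t)).re) 0 τ :=
      (hasDerivAt_const τ (0 : ℝ)).congr_of_eventuallyEq
        (by filter_upwards [Ioo_mem_nhds hτ.1 hτ.2] with t ht using hwQ t ht)
    have e := hd.unique h0
    have e2 : star (P τ * s τ) * q * s τ + star (s τ) * q * (P τ * s τ)
        = (2 : ℝ) • (star (s τ) * (q * P τ) * s τ) := by
      rw [star_mul, (hP τ).star_left, mul_neg, neg_mul, neg_mul, mul_assoc (star (s τ)) (P τ),
        ← neg_mul, ← mul_neg, ← (hP τ).anticomm]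
      simp only [mul_assoc, two_smul]
    rw [e2, mul_smul_comm, Quaternion.re_smul, smul_eq_mul] at e
    linarith
  -- In the moving frame, `z` is orthogonal to `q` and `q * P`, so it is parallel to the generator
  -- `P`. Then $z'=Pz-zP=0$, and the fixed vector `w` commutes with `P t` for all `t`.
  set z : ℝ → ℍ[ℝ] := fun t => s t * w * star (s t) with hz
  have hzc : ContinuousOn z (Icc 0 T) := by
    have h1 : ContinuousOn s (Icc 0 T) := fun t ht => (hsd t ht).continuousAt.continuousWithinAt
    have h2 : ContinuousOn (fun t => star (s t)) (Icc 0 T) :=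
      fun t ht => (hasDerivAt_star (hsd t ht)).continuousAt.continuousWithinAt
    exact (h1.mul continuousOn_const).mul h2
  have hPc : Continuous P := by
    have := continuous_rot q
    fun_prop
  have hcomm : ∀ t ∈ Icc 0 T, z t * P t = P t * z t := by
    have hI : EqOn (fun t => z t * P t) (fun t => P t * z t) (Ioo 0 T) := fun t ht => by
      refine commute_of_re_mul_eq_zero (hP t) ?_ ?_ ?_
      · simp [hz, hstar, mul_assoc]
      · rw [hz, mul_assoc, mul_assoc, re_mul_comm]
        simpa only [mul_assoc] using hwQ t ht
      · rw [hz, mul_assoc, mul_assoc, re_mul_comm]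
        simpa only [mul_assoc] using hwQ' t ht
    exact hI.of_subset_closure (hzc.mul hPc.continuousOn) (hPc.continuousOn.mul hzc)
      Ioo_subset_Icc_self (by rw [closure_Ioo hT.ne])
  have hz0 : ∀ t ∈ Icc 0 T, z t = w := fun t ht => by
    have hd : ∀ t ∈ Icc 0 T, HasDerivAt z 0 t := fun t ht => by
      refine (((hsd t ht).mul_const w).mul (hasDerivAt_star (hsd t ht))).congr_deriv ?_
      have := hcomm t ht
      rw [star_mul, (hP t).star_left]
      calc _ = P t * z t - z t * P t := by simp only [hz]; noncomm_ring
        _ = 0 := by rw [this, sub_self]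
    rw [eq_of_hasDerivAt_zero hd t ht]
    simp [hz, hs.initial]
  have hwP : ∀ t ∈ Icc 0 T, w * P t = P t * w := fun t ht => by
    have := hcomm t ht
    rwa [hz0 t ht] at this
  have hwp : w * p = p * w := by
    have := hwP 0 ⟨le_rfl, hT.le⟩
    simpa [P, hF0, rot_zero] using this
  have hwq : w * q = -(q * w) := by
    refine anticomm_of_re_mul_eq_zero hstar h.star_right ?_
    have hc : ContinuousOn (fun t => (w * (star (s t) * q * s t)).re) (Icc 0 T) := fun t ht =>
      (hasDerivAt_re (((hasDerivAt_star (hsd t ht)).mul_const q).mul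
        (hsd t ht) |>.const_mul w)).continuousAt.continuousWithinAt
    have hI : EqOn (fun t => (w * (star (s t) * q * s t)).re) (fun _ => 0) (Icc 0 T) :=
      EqOn.of_subset_closure (s := Ioo 0 T) hwQ hc continuousOn_const
        Ioo_subset_Icc_self (by rw [closure_Ioo hT.ne])
    simpa [hs.initial] using hI ⟨le_rfl, hT.le⟩
  refine ⟨eq_zero_of_sin_two_mul_eq_zero hF hF0 fun t ht => ?_, ?_⟩
  -- Since `w` commutes with `p` and with `P t`, a nonzero sine would make it commute with `q`; but
  -- `w` anticommutes with `q` and is nonzero.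
  · by_contra hsin
    have h1 := hwP t ht
    simp only [P, rot, mul_add, add_mul, mul_smul_comm, smul_mul_assoc, mul_one] at h1
    rw [hwp, add_right_inj] at h1
    have h2 := smul_right_injective _ hsin h1
    have h3 : p * (w * q) = p * (q * w) := by
      simpa only [← mul_assoc, hwp] using h2
    have h4 := mul_left_cancel₀ h.left_ne_zero h3
    rw [hwq, neg_eq_iff_add_eq_zero, ← two_smul ℝ, smul_eq_zero] at h4
    rcases mul_eq_zero.1 (h4.resolve_left two_ne_zero) with h5 | h5
    · rw [h5] at hwq
      simpa [h5] using h.sq_right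
    · exact hne h5
  · rw [hyw, add_mul, mul_add, hwp, Quaternion.coe_commutes]

/-! ### The uncontrolled flow and the second-order test. -/

lemma AxisPair.normalized_mul_self (h : AxisPair p q) :
    (‖p‖⁻¹ • p) * (‖p‖⁻¹ • p) = -1 := by
  have h1 : p * p = -((‖p‖ * ‖p‖ : ℝ) : ℍ[ℝ]) := by
    rw [← Quaternion.normSq_eq_norm_mul_self, ← Quaternion.self_mul_star, h.star_left, mul_neg,
      neg_neg]
  have h2 : ‖p‖ ≠ 0 := norm_ne_zero_iff.2 h.left_ne_zero
  rw [smul_mul_smul_comm, h1, smul_neg, ← Quaternion.coe_smul, smul_eq_mul]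
  field_simp
  simp

/-- Without control the flow is the rotation about the drift axis. -/
lemma IsFlow.eq_rot (h : AxisPair p q) (hs : IsFlow p q T F s)
    (hF : ∀ t ∈ Icc 0 T, F t = 0) {t : ℝ} (ht : t ∈ Icc 0 T) :
    s t = rot (‖p‖⁻¹ • p) (‖p‖ * t) := by
  set n := ‖p‖⁻¹ • p with hn
  have hnn : n * n = -1 := h.normalized_mul_self
  have hns : star n = -n := by
    rw [hn, Quaternion.star_smul, h.star_left, smul_neg]
  have hp : p = ‖p‖ • n := by
    rw [hn, smul_smul, mul_inv_cancel₀ (norm_ne_zero_iff.2 h.left_ne_zero), one_smul]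
  have hd : ∀ t ∈ Icc 0 T, HasDerivAt (fun t => star (rot n (‖p‖ * t)) * s t) 0 t := by
    intro t ht
    have h1 : HasDerivAt (fun t => rot n (‖p‖ * t)) (p * rot n (‖p‖ * t)) t := by
      refine (HasDerivAt.scomp t (hasDerivAt_rot hnn (‖p‖ * t))
        ((hasDerivAt_id t).const_mul ‖p‖)).congr_deriv ?_
      conv_rhs => rw [hp, smul_mul_assoc, ← hp]
      simp
    refine ((hasDerivAt_star h1).mul (hs.hasDerivAt t ht)).congr_deriv ?_
    rw [hF t ht, mul_zero, rot_zero, mul_one, star_mul, h.star_left]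
    simp [mul_assoc]
  have h2 := eq_of_hasDerivAt_zero hd t ht
  rw [hs.initial] at h2
  simp only [mul_zero, rot_zero, star_one, mul_one] at h2
  have h3 := mul_star_self_of_star_mul_self (star_mul_self_rot hns hnn (‖p‖ * t))
  calc s t = rot n (‖p‖ * t) * (star (rot n (‖p‖ * t)) * s t) := by
        rw [← mul_assoc, h3, one_mul]
    _ = _ := by rw [h2, mul_one]

/-- The difference of squared cosines is $\sin(2\theta-2x)\sin 2x$, which depends on $\theta$ only
through its residue $\varphi\in(0,\pi)$ modulo $\pi$. It is positive for small $x>0$ if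
$\varphi\le\pi/2$, and for $\varphi-\pi/2<x<\pi/2$ otherwise. In the second case the hypothesis on
`a` or on `θ` ensures that `D` exceeds $\varphi-\pi/2$. -/
lemma exists_cos_sq_lt {θ a D : ℝ} (hD : 0 < D) (hθ : θ = a + D) (hsin : Real.sin θ ≠ 0)
    (ha : 0 < a) (haπ : a ≤ Real.pi) (h : a < Real.pi / 2 ∨ Real.pi < θ) :
    ∃ x ∈ Ioo 0 D, |Real.cos θ| < |Real.cos (θ - 2 * x)| := by
  have key : ∀ x, 0 < Real.sin (2 * θ - 2 * x) * Real.sin (2 * x) →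
      |Real.cos θ| < |Real.cos (θ - 2 * x)| := fun x hx => by
    rw [← sq_lt_sq, Real.cos_sq θ, Real.cos_sq (θ - 2 * x)]
    have := Real.cos_sub_cos (2 * (θ - 2 * x)) (2 * θ)
    rw [show (2 * (θ - 2 * x) + 2 * θ) / 2 = 2 * θ - 2 * x by ring,
      show (2 * (θ - 2 * x) - 2 * θ) / 2 = -(2 * x) by ring, Real.sin_neg] at this
    linarith
  have hπ := Real.pi_pos
  set k := ⌊θ / Real.pi⌋ with hk
  set φ := θ - k * Real.pi with hφ
  have hφ0 : 0 ≤ φ := by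
    have := Int.floor_le (θ / Real.pi)
    rw [le_div_iff₀ hπ] at this
    linarith
  have hφ1 : φ < Real.pi := by
    have := Int.lt_floor_add_one (θ / Real.pi)
    rw [div_lt_iff₀ hπ] at this
    linarith
  have hφ2 : φ ≠ 0 := fun h0 => hsin (by
    rw [show θ = k * Real.pi by linarith]; exact Real.sin_int_mul_pi k)
  have hφ3 : 0 < φ := lt_of_le_of_ne hφ0 hφ2.symm
  have hsin2 : ∀ x, Real.sin (2 * θ - 2 * x) = Real.sin (2 * φ - 2 * x) := fun x => by
    rw [show 2 * θ - 2 * x = 2 * φ - 2 * x + k * (2 * Real.pi) by rw [hφ]; ring,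
      Real.sin_add_int_mul_two_pi]
  by_cases hc : φ ≤ Real.pi / 2
  · -- short times already help
    set x := min D φ / 2 with hx
    have hm : 0 < min D φ := lt_min hD hφ3
    have hxD : min D φ ≤ D := min_le_left _ _
    have hxφ : min D φ ≤ φ := min_le_right _ _
    refine ⟨x, ⟨by linarith, by linarith⟩, key x ?_⟩
    rw [hsin2]
    exact mul_pos (Real.sin_pos_of_pos_of_lt_pi (by linarith) (by linarith))
      (Real.sin_pos_of_pos_of_lt_pi (by linarith) (by linarith))
  · push Not at hc
    have hgap : φ - Real.pi / 2 < D := by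
      have hk0 : (0 : ℝ) ≤ k := by
        have : (0 : ℤ) ≤ k := Int.floor_nonneg.2 (div_nonneg (by linarith) hπ.le)
        exact_mod_cast this
      rcases h with h | h
      · nlinarith
      · have : (1 : ℝ) ≤ k := by
          have : (1 : ℤ) ≤ k := Int.le_floor.2 (by rw [le_div_iff₀ hπ]; push_cast; linarith)
          exact_mod_cast this
        nlinarith
    -- The midpoint of the admissible interval makes both $2\varphi-2x$ and $2x$ lie in $(0,\pi)$.
    set x := (φ - Real.pi / 2 + min D (Real.pi / 2)) / 2 with hx
    have hm : φ - Real.pi / 2 < min D (Real.pi / 2) := lt_min hgap (by linarith)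
    have hxD : min D (Real.pi / 2) ≤ D := min_le_left _ _
    have hxφ : min D (Real.pi / 2) ≤ Real.pi / 2 := min_le_right _ _
    refine ⟨x, ⟨by linarith, by linarith⟩, key x ?_⟩
    rw [hsin2]
    exact mul_pos (Real.sin_pos_of_pos_of_lt_pi (by linarith) (by linarith))
      (Real.sin_pos_of_pos_of_lt_pi (by linarith) (by linarith))

/-- Smeared impulses of total strength less than `δ` do not increase the overlap with `ω`. -/
def ImpulseMaximal (p q ω : ℍ[ℝ]) (T : ℝ) (F : ℝ → ℝ) (s : ℝ → ℍ[ℝ]) (δ : ℝ) : Prop :=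
  ∀ τ₁ τ₂ ε₁ ε₂ : ℝ, 0 < τ₁ → τ₁ < τ₂ → τ₂ < T → |ε₁| + |ε₂| < δ →
    ∀ η > 0, τ₁ + η ≤ τ₂ → τ₂ + η ≤ T → ∃ E σ, IsFlow p q T E σ ∧
      (∀ t ∈ Icc 0 τ₁, E t = F t) ∧ (∀ t ∈ Icc (τ₁ + η) τ₂, E t = F t + ε₁) ∧
      (∀ t ∈ Icc (τ₂ + η) T, E t = F t + (ε₁ + ε₂)) ∧
      |(star ω * (rot q (E T) * σ T)).re| ≤ |(star ω * (rot q (F T) * s T)).re|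

lemma norm_overlap (h : AxisPair p q) (hs : IsFlow p q T F s) (hT : 0 ≤ T) {ω : ℍ[ℝ]}
    (hω : ‖ω‖ = 1) : ‖star ω * (rot q (F T) * s T)‖ = 1 := by
  simp only [norm_mul, Quaternion.norm_star, hω, norm_rot h.star_right h.sq_right,
    hs.norm_eq_one h ⟨hT, le_rfl⟩, mul_one]

/-- First-order condition: the second impulse has strength zero and sits at a dummy later time. -/
lemma ImpulseMaximal.orthogonal (h : AxisPair p q) (hs : IsFlow p q T F s) {ω : ℍ[ℝ]} {δ : ℝ}
    (hω : ‖ω‖ = 1) (hδ : 0 < δ) (hmax : ImpulseMaximal p q ω T F s δ) {τ : ℝ}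
    (hτ : τ ∈ Ioo 0 T) :
    (star ω * (rot q (F T) * s T) * transport q s τ).re = 0 := by
  refine eq_zero_of_abs_cos_add_sin_le
    (A := (star ω * (rot q (F T) * s T)).re) hδ fun ε hε => ?_
  rw [← re_mul_rot]
  have h1 : τ < (τ + T) / 2 := by linarith [hτ.2]
  have h2 : (τ + T) / 2 < T := by linarith [hτ.2]
  have := abs_re_impulse_le h hs hω (ε₁ := ε) (ε₂ := 0) hτ.1 h1 h2
    (hmax _ _ _ _ hτ.1 h1 h2 (by simpa using hε))
  rwa [rot_zero, one_mul] at this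

lemma ImpulseMaximal.abs_re_le (h : AxisPair p q) (hs : IsFlow p q T F s) {ω : ℍ[ℝ]} {δ : ℝ}
    (hω : ‖ω‖ = 1) (hδ : 0 < δ) (hmax : ImpulseMaximal p q ω T F s δ) {τ₁ τ₂ : ℝ}
    (h₁ : 0 < τ₁) (h₁₂ : τ₁ < τ₂) (h₂ : τ₂ < T) :
    |(star ω * (rot q (F T) * s T) * (transport q s τ₂ * transport q s τ₁)).re|
      ≤ |(star ω * (rot q (F T) * s T)).re| :=
  abs_re_mul_mul_le hδ (hmax.orthogonal h hs hω hδ ⟨h₁, h₁₂.trans h₂⟩)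
    (hmax.orthogonal h hs hω hδ ⟨h₁.trans h₁₂, h₂⟩)
    fun _ _ hε => abs_re_impulse_le h hs hω h₁ h₁₂ h₂ (hmax _ _ _ _ h₁ h₁₂ h₂ hε)

lemma star_normalized (hp : star p = -p) : star (‖p‖⁻¹ • p) = -(‖p‖⁻¹ • p) := by
  rw [Quaternion.star_smul, hp, smul_neg]

lemma re_rot {n : ℍ[ℝ]} (hn : star n = -n) (x : ℝ) : (rot n x).re = Real.cos x := by
  simp [rot, re_eq_zero_of_star hn]

/-- A non-optimal impulse-maximal control vanishes, its target commutes with the drift, and the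
second-order conditions hold. -/
theorem ImpulseMaximal.commute_and_cos_le (h : AxisPair p q) (hT : 0 < T) (hF : Continuous F)
    (hF0 : F 0 = 0) (hs : IsFlow p q T F s) {ω : ℍ[ℝ]} {δ : ℝ} (hω : ‖ω‖ = 1) (hδ : 0 < δ)
    (hmax : ImpulseMaximal p q ω T F s δ) (hne : |(star ω * (rot q (F T) * s T)).re| ≠ 1) :
    ω * p = p * ω ∧ ∀ a, ω = rot (‖p‖⁻¹ • p) (-a) → Real.sin (a + ‖p‖ * T) ≠ 0 ∧
      ∀ x ∈ Ioo 0 (‖p‖ * T),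
        |Real.cos (a + ‖p‖ * T - 2 * x)| ≤ |Real.cos (a + ‖p‖ * T)| := by
  have mT : T ∈ Icc 0 T := ⟨hT.le, le_rfl⟩
  have hy1 := norm_overlap h hs hT.le hω
  -- A unit quaternion without imaginary part is $\pm1$, which is the optimal value.
  have him : (star ω * (rot q (F T) * s T)).im ≠ 0 := fun h0 => hne (by
    rw [← Quaternion.re_add_im (star ω * (rot q (F T) * s T)), h0, add_zero,
      Quaternion.norm_coe] at hy1
    exact hy1)
  obtain ⟨hFz, hyp⟩ := hs.eq_zero_of_orthogonal h hT hF hF0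
    (fun τ hτ => hmax.orthogonal h hs hω hδ hτ) him
  have hd : ‖p‖ ≠ 0 := norm_ne_zero_iff.2 h.left_ne_zero
  have hd0 : 0 < ‖p‖ := norm_pos_iff.2 h.left_ne_zero
  set n := ‖p‖⁻¹ • p with hn
  have hnn : n * n = -1 := h.normalized_mul_self
  have hns : star n = -n := star_normalized h.star_left
  have hsT : ∀ t ∈ Icc 0 T, s t = rot n (‖p‖ * t) := fun t ht => hs.eq_rot h hFz ht
  have hy : star ω * (rot q (F T) * s T) = star ω * rot n (‖p‖ * T) := by
    rw [hFz T mT, rot_zero, one_mul, hsT T mT]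
  have hqn : n * q = -(q * n) := by
    rw [hn, smul_mul_assoc, mul_smul_comm, h.anticomm, smul_neg, neg_neg]
  have hQ : ∀ t ∈ Icc 0 T, transport q s t = q * rot n (2 * (‖p‖ * t)) := fun t ht => by
    rw [transport, hsT t ht, star_rot hns, Qubit.mul_rot hqn, neg_neg, mul_assoc, ← rot_add hnn,
      two_mul]
  rw [hy] at hyp
  refine ⟨?_, fun a ha => ?_⟩
  · set R := rot n (‖p‖ * T)
    have hR : R * star R = 1 := mul_star_self_of_star_mul_self (star_mul_self_rot hns hnn _)
    have hRp : p * R = R * p := by simp [R, rot, hn, mul_add, add_mul]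
    have h1 : p * (star R * ω) = star R * ω * p := by
      have := congrArg star hyp
      rw [star_mul, star_mul, star_mul p, star_mul, star_star, h.star_left] at this
      simpa [mul_assoc] using this
    calc ω * p = R * star R * ω * p := by rw [hR, one_mul]
      _ = R * (p * (star R * ω)) := by rw [h1]; simp only [mul_assoc]
      _ = R * p * star R * ω := by simp only [mul_assoc]
      _ = p * (R * star R) * ω := by rw [← hRp]; simp only [mul_assoc]
      _ = p * ω := by rw [hR, mul_one]
  · have hyθ : star ω * (rot q (F T) * s T) = rot n (a + ‖p‖ * T) := by
      rw [hy, ha, star_rot hns, neg_neg, ← rot_add hnn]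
    rw [hyθ, re_rot hns] at hne
    refine ⟨fun h0 => hne ?_, fun x hx => ?_⟩
    · have := Real.sin_sq_add_cos_sq (a + ‖p‖ * T)
      rw [h0] at this
      rw [← sq_eq_sq₀ (abs_nonneg _) zero_le_one, sq_abs]
      linarith
    · have hx1 : 0 < x / ‖p‖ := div_pos hx.1 hd0
      have hx2 : x / ‖p‖ < T := by rw [div_lt_iff₀ hd0, mul_comm]; exact hx.2
      -- The impulses are placed symmetrically about $T/2$ at distance `τ`, so their rotation angles
      -- differ by $2x$ and the product of the transported directions is $-e^{-2xn}$.
      set τ := x / ‖p‖ with hτ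
      have hxτ : x = ‖p‖ * τ := by rw [hτ]; field_simp
      have i1 : 0 < (T - τ) / 2 := by linarith
      have i12 : (T - τ) / 2 < (T + τ) / 2 := by linarith
      have i2 : (T + τ) / 2 < T := by linarith
      have key := hmax.abs_re_le h hs hω hδ i1 i12 i2
      rw [hyθ, hQ _ ⟨(i1.trans i12).le, i2.le⟩, hQ _ ⟨i1.le, (i12.trans i2).le⟩] at key
      have e : q * rot n (2 * (‖p‖ * ((T + τ) / 2))) * (q * rot n (2 * (‖p‖ * ((T - τ) / 2))))
          = - rot n (-(2 * x)) := by
        rw [← mul_assoc, mul_assoc q, Qubit.mul_rot hqn, ← mul_assoc, h.sq_right, mul_assoc,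
          ← rot_add hnn, neg_one_mul, hxτ]
        ring_nf
      rw [e, mul_neg, ← rot_add hnn, Quaternion.re_neg, abs_neg, re_rot hns, re_rot hns,
        ← sub_eq_add_neg] at key
      exact key

end Flow

/-! ### Quaternions as matrices -/

/-- The standard embedding of the quaternions into the `2 × 2` complex matrices. -/
noncomputable def toMat : ℍ[ℝ] →ₐ[ℝ] Mat where
  toFun x := !![⟨x.re, x.imI⟩, ⟨x.imJ, x.imK⟩; ⟨-x.imJ, x.imK⟩, ⟨x.re, -x.imI⟩]
  map_one' := by
    ext i j; fin_cases i <;> fin_cases j <;> apply Complex.ext <;> simp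
  map_zero' := by
    ext i j; fin_cases i <;> fin_cases j <;> apply Complex.ext <;> simp
  map_add' x y := by
    ext i j; fin_cases i <;> fin_cases j <;> apply Complex.ext <;> simp <;> ring
  map_mul' x y := by
    ext i j
    fin_cases i <;> fin_cases j <;> apply Complex.ext <;>
      simp [Matrix.mul_apply, Fin.sum_univ_two] <;> ring
  commutes' r := by
    ext i j; fin_cases i <;> fin_cases j <;> apply Complex.ext <;>
      simp [Matrix.algebraMap_matrix_apply]

lemma toMat_apply (x : ℍ[ℝ]) :
    toMat x = !![⟨x.re, x.imI⟩, ⟨x.imJ, x.imK⟩; ⟨-x.imJ, x.imK⟩, ⟨x.re, -x.imI⟩] := rfl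

lemma toMat_star (x : ℍ[ℝ]) : toMat (star x) = (toMat x)ᴴ := by
  ext i j
  fin_cases i <;> fin_cases j <;> apply Complex.ext <;> simp [toMat_apply]

lemma trace_toMat (x : ℍ[ℝ]) : (toMat x).trace = 2 * (x.re : ℂ) := by
  simp [toMat_apply, Matrix.trace, Fin.sum_univ_two]
  apply Complex.ext <;> simp
  ring

lemma toMat_injective : Function.Injective toMat := toMat.toRingHom.injective

lemma exists_toMat_eq {M : Mat} (h₁ : M 1 1 = star (M 0 0)) (h₂ : M 1 0 = -star (M 0 1)) :
    ∃ x, toMat x = M := by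
  obtain ⟨x, hx₀, hx₁, hx₂, hx₃⟩ : ∃ x : ℍ[ℝ], x.re = (M 0 0).re ∧ x.imI = (M 0 0).im ∧
      x.imJ = (M 0 1).re ∧ x.imK = (M 0 1).im :=
    ⟨⟨(M 0 0).re, (M 0 0).im, (M 0 1).re, (M 0 1).im⟩, rfl, rfl, rfl, rfl⟩
  refine ⟨x, ?_⟩
  ext i j
  fin_cases i <;> fin_cases j <;> apply Complex.ext <;>
    simp [toMat_apply, h₁, h₂, hx₀, hx₁, hx₂, hx₃]

/-- Every unitary matrix is a phase times a unit quaternion. -/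
lemma exists_phase_smul_toMat {W : Mat} (hW : W ∈ Matrix.unitaryGroup (Fin 2) ℂ) :
    ∃ (γ : ℝ) (ω : ℍ[ℝ]), ‖ω‖ = 1 ∧ W = Complex.exp (Complex.I * γ) • toMat ω := by
  have hWW : Wᴴ * W = 1 := hW.1
  have hdet : ‖W.det‖ = 1 := by
    have h := congrArg Matrix.det hWW
    rw [Matrix.det_mul, Matrix.det_conjTranspose, Matrix.det_one] at h
    have h2 := congrArg norm h
    rw [norm_mul, Complex.star_def, Complex.norm_conj, norm_one] at h2
    nlinarith [norm_nonneg W.det]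
  -- Half the argument of the determinant: removing this phase leaves determinant $1$. The adjugate
  -- then equals the conjugate transpose, which is the quaternionic form of the entries.
  set γ := W.det.arg / 2 with hγ
  set c := Complex.exp (Complex.I * γ) with hc
  have hcc : c * c = W.det := by
    rw [hc, ← Complex.exp_add]
    conv_rhs => rw [← Complex.norm_mul_exp_arg_mul_I W.det, hdet]
    rw [hγ]; push_cast
    rw [one_mul]; congr 1; ring
  have hstarc : star c * c = 1 := by
    have : ‖c‖ = 1 := by rw [hc, mul_comm, Complex.norm_exp_ofReal_mul_I]
    have h2 := Complex.conj_mul' c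
    rw [this] at h2
    simpa using h2
  set M := star c • W with hM
  have hWM : W = c • M := by rw [hM, smul_smul, mul_comm, hstarc, one_smul]
  have hadj : M.adjugate = Mᴴ := by
    have hMM : Mᴴ * M = 1 := by
      rw [hM, Matrix.conjTranspose_smul, star_star, smul_mul_smul_comm, hWW, mul_comm, hstarc,
        one_smul]
    have hdetM : M.det = 1 := by
      rw [hM, Matrix.det_smul, Fintype.card_fin, ← hcc]
      linear_combination (star c * c + 1) * hstarc
    calc M.adjugate = (Mᴴ * M) * M.adjugate := by rw [hMM, one_mul]
      _ = _ := by rw [mul_assoc, Matrix.mul_adjugate, hdetM, one_smul, mul_one]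
  rw [Matrix.adjugate_fin_two] at hadj
  have e1 : M 1 1 = star (M 0 0) := by simpa using congrFun (congrFun hadj 0) 0
  have e2 : M 1 0 = -star (M 0 1) := by
    have := congrFun (congrFun hadj 1) 0
    simp at this
    simpa using congrArg Neg.neg this
  obtain ⟨ω, hω⟩ := exists_toMat_eq e1 e2
  refine ⟨γ, ω, norm_eq_one_of_star_mul_self (toMat_injective ?_), by rw [hω]; exact hWM⟩
  rw [map_mul, toMat_star, hω, map_one, hM, Matrix.conjTranspose_smul, star_star,
    smul_mul_smul_comm, hWW, mul_comm, hstarc, one_smul]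

/-- The imaginary quaternion that represents `-i` times the traceless part of a Hermitian
matrix. -/
noncomputable def axis (A : Mat) : ℍ[ℝ] :=
  ⟨0, -((A 0 0).re - (A 1 1).re) / 2, (A 0 1).im, -(A 0 1).re⟩

@[simp] lemma axis_re (A : Mat) : (axis A).re = 0 := rfl

@[simp] lemma axis_imI (A : Mat) : (axis A).imI = -((A 0 0).re - (A 1 1).re) / 2 := rfl

@[simp] lemma axis_imJ (A : Mat) : (axis A).imJ = (A 0 1).im := rfl

@[simp] lemma axis_imK (A : Mat) : (axis A).imK = -(A 0 1).re := rfl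

lemma star_axis (A : Mat) : star (axis A) = -axis A := by
  ext <;> simp

lemma trace_eq_re {A : Mat} (hA : A.IsHermitian) : A.trace = (A.trace.re : ℂ) := by
  rw [eq_comm]
  apply Complex.conj_eq_iff_re.1
  have := Matrix.trace_conjTranspose A
  rw [hA.eq] at this
  exact this.symm

lemma eq_trace_add_axis {A : Mat} (hA : A.IsHermitian) :
    A = (A.trace.re / 2) • (1 : Mat) + Complex.I • toMat (axis A) := by
  have h0 : (A 0 0).im = 0 := by
    have := congrArg Complex.im (hA.apply 0 0); simp at this; linarith
  have h1 : (A 1 1).im = 0 := by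
    have := congrArg Complex.im (hA.apply 1 1); simp at this; linarith
  have h2 : A 1 0 = star (A 0 1) := (hA.apply 1 0).symm
  ext i j
  fin_cases i <;> fin_cases j <;> apply Complex.ext <;>
    simp [toMat_apply, Matrix.trace, Fin.sum_univ_two, h0, h1, h2] <;> ring

lemma trace_mul_re {A B : Mat} (hA : A.IsHermitian) (hB : B.IsHermitian) :
    (A * B).trace.re = A.trace.re * B.trace.re / 2 - 2 * (axis A * axis B).re := by
  conv_lhs => rw [eq_trace_add_axis hA, eq_trace_add_axis hB]
  simp only [mul_add, add_mul, one_mul, mul_one, smul_mul_assoc,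
    mul_smul_comm, ← map_mul, Matrix.trace_add, Matrix.trace_smul, trace_toMat, axis_re,
    Matrix.trace_one, Fintype.card_fin]
  simp
  ring

/-! ### The special control -/

/-- The quaternion of the special Hamiltonian. -/
noncomputable def drift (H₀ V : Mat) : ℍ[ℝ] := axis H₀ + specialControl H₀ V • axis V

/-- The unit quaternion of the control operator. -/
noncomputable def direction (V : Mat) : ℍ[ℝ] := ‖axis V‖⁻¹ • axis V

variable {H₀ V W : Mat}

lemma axis_mul_self (A : Mat) : axis A * axis A = -((‖axis A‖ ^ 2 : ℝ) : ℍ[ℝ]) := by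
  rw [sq, ← Quaternion.normSq_eq_norm_mul_self, ← Quaternion.self_mul_star, star_axis, mul_neg,
    neg_neg]

/-- The products of traces cancel. As $\operatorname{Re}(ab)=-\langle a,b\rangle$ for imaginary
quaternions, $f_0$ is the coefficient that removes from `axis H₀` its projection on `axis V`. -/
lemma specialControl_eq (hH₀ : H₀.IsHermitian) (hV : V.IsHermitian) :
    specialControl H₀ V = (axis H₀ * axis V).re / ‖axis V‖ ^ 2 := by
  have h : (axis V * axis V).re = -‖axis V‖ ^ 2 := by
    rw [axis_mul_self, Quaternion.re_neg, Quaternion.re_coe]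
  rw [specialControl, trace_mul_re hH₀ hV, trace_mul_re hV hV, h,
    show -(H₀.trace.re * V.trace.re) + 2 * (H₀.trace.re * V.trace.re / 2
      - 2 * (axis H₀ * axis V).re) = -4 * (axis H₀ * axis V).re by ring,
    show V.trace.re ^ 2 - 2 * (V.trace.re * V.trace.re / 2 - 2 * -‖axis V‖ ^ 2)
      = -4 * ‖axis V‖ ^ 2 by ring, mul_div_mul_left _ _ (by norm_num)]

lemma commutator_eq_zero (hH₀ : H₀.IsHermitian) (hV : V.IsHermitian)
    (h : axis H₀ * axis V = axis V * axis H₀) : ⁅H₀, V⁆ = 0 := by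
  have h2 := congrArg toMat h
  rw [map_mul, map_mul] at h2
  rw [Ring.lie_def, eq_trace_add_axis hH₀, eq_trace_add_axis hV]
  simp only [mul_add, add_mul, mul_one, one_mul, smul_mul_assoc, mul_smul_comm, h2]
  module

lemma axis_ne_zero (hH₀ : H₀.IsHermitian) (hV : V.IsHermitian) (hHV : ⁅H₀, V⁆ ≠ 0) :
    axis V ≠ 0 := fun h => hHV (commutator_eq_zero hH₀ hV (by simp [h]))

lemma axisPair (hH₀ : H₀.IsHermitian) (hV : V.IsHermitian) (hHV : ⁅H₀, V⁆ ≠ 0) :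
    AxisPair (drift H₀ V) (direction V) := by
  have hy := axis_ne_zero hH₀ hV hHV
  have hn : ‖axis V‖ ≠ 0 := norm_ne_zero_iff.2 hy
  have hs : star (drift H₀ V) = -drift H₀ V := by
    rw [drift, star_add, Quaternion.star_smul, star_axis, star_axis, smul_neg, neg_add]
  refine ⟨hs, star_normalized (star_axis V), ?_, ?_, fun h => hHV ?_⟩
  · have : (drift H₀ V * axis V).re = 0 := by
      rw [drift, add_mul, smul_mul_assoc, axis_mul_self, Quaternion.re_add, Quaternion.re_smul,
        Quaternion.re_neg, Quaternion.re_coe, specialControl_eq hH₀ hV, smul_eq_mul]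
      field_simp
      ring
    have h := anticomm_of_re_mul_eq_zero hs (star_axis V) this
    rw [direction, smul_mul_assoc, mul_smul_comm, h, smul_neg, neg_neg]
  · rw [direction, smul_mul_smul_comm, axis_mul_self, smul_neg, ← Quaternion.coe_smul, smul_eq_mul]
    field_simp
    simp
  -- A vanishing drift would make `axis H₀` a multiple of `axis V`.
  · refine commutator_eq_zero hH₀ hV ?_
    rw [drift, add_eq_zero_iff_eq_neg] at h
    rw [h]; simp

/-- Half of the trace of the special Hamiltonian. -/
noncomputable def specialMean (H₀ V : Mat) : ℝ :=
  H₀.trace.re / 2 + specialControl H₀ V * (V.trace.re / 2)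

lemma specialHamiltonian_eq (hH₀ : H₀.IsHermitian) (hV : V.IsHermitian) :
    specialHamiltonian H₀ V
      = specialMean H₀ V • (1 : Mat) + Complex.I • toMat (drift H₀ V) := by
  conv_lhs => rw [specialHamiltonian]
  set c := specialControl H₀ V with hc
  conv_lhs => rw [eq_trace_add_axis hH₀, eq_trace_add_axis hV]
  rw [specialMean, drift, ← hc, map_add, map_smul, smul_add, smul_add, smul_comm c Complex.I]
  module

lemma specialNorm_eq (hH₀ : H₀.IsHermitian) (hV : V.IsHermitian) :
    specialNorm H₀ V = ‖drift H₀ V‖ := by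
  have h1 : H₀ + specialControl H₀ V • V - (H₀.trace / 2) • (1 : Mat)
      - specialControl H₀ V • ((V.trace / 2) • (1 : Mat)) = Complex.I • toMat (drift H₀ V) := by
    have h := specialHamiltonian_eq hH₀ hV
    rw [specialHamiltonian] at h
    rw [h, specialMean, trace_eq_re hH₀, trace_eq_re hV]
    ext i j
    fin_cases i <;> fin_cases j <;> simp <;> ring
  rw [specialNorm, h1, opNorm]
  set p := drift H₀ V with hp
  set A := Matrix.toEuclideanCLM (n := Fin 2) (𝕜 := ℂ) (Complex.I • toMat p) with hA
  -- The matrix is `‖p‖` times a unitary, so the C*-identity gives its norm.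
  have h2 : star A * A = ((‖p‖ ^ 2 : ℝ) : ℂ) • 1 := by
    rw [hA, ← map_star, ← map_mul, Matrix.star_eq_conjTranspose, Matrix.conjTranspose_smul,
      ← toMat_star, smul_mul_smul_comm, ← map_mul, Quaternion.star_mul_self,
      Quaternion.normSq_eq_norm_mul_self, ← sq]
    have : toMat ((‖p‖ ^ 2 : ℝ) : ℍ[ℝ]) = ((‖p‖ ^ 2 : ℝ) : ℂ) • (1 : Mat) := by
      rw [show ((‖p‖ ^ 2 : ℝ) : ℍ[ℝ]) = algebraMap ℝ ℍ[ℝ] (‖p‖ ^ 2) from rfl, AlgHom.commutes,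
        Algebra.algebraMap_eq_smul_one, Complex.coe_smul]
    rw [this]
    simp
  have h3 : ‖A‖ * ‖A‖ = ‖p‖ ^ 2 := by
    rw [← CStarRing.norm_star_mul_self, h2, norm_smul, norm_one, mul_one, Complex.norm_real,
      Real.norm_of_nonneg (by positivity)]
  nlinarith [norm_nonneg A, norm_nonneg p]

/-! ### Solutions of the Schrödinger equation -/

/-- The integral of the control over `[0, t]`. -/
noncomputable def primitive (T : ℝ) (f : ℝ → ℝ) (t : ℝ) : ℝ :=
  ∫ x in (0 : ℝ)..t, (Icc 0 T).indicator f x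

/-- The angle by which the control rotates about its axis, relative to the special control. -/
noncomputable def angle (H₀ V : Mat) (T : ℝ) (f : ℝ → ℝ) (t : ℝ) : ℝ :=
  ‖axis V‖ * (primitive T f t - specialControl H₀ V * t)

/-- The phase due to the traces of `H₀` and `V`. -/
noncomputable def phase (H₀ V : Mat) (T : ℝ) (f : ℝ → ℝ) (t : ℝ) : ℝ :=
  H₀.trace.re / 2 * t + V.trace.re / 2 * primitive T f t

variable {T : ℝ} {f : ℝ → ℝ}

lemma continuous_primitive (hf : IntegrableOn f (Icc 0 T)) : Continuous (primitive T f) :=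
  intervalIntegral.continuous_primitive
    (fun _ _ => (integrable_indicator_iff measurableSet_Icc |>.2 hf).intervalIntegrable) 0

lemma continuous_angle (hf : IntegrableOn f (Icc 0 T)) : Continuous (angle H₀ V T f) := by
  have := continuous_primitive hf
  unfold angle; fun_prop

lemma angle_zero : angle H₀ V T f 0 = 0 := by simp [angle, primitive]

lemma ae_hasDerivAt_primitive (hf : IntegrableOn f (Icc 0 T)) :
    ∀ᵐ t ∂(volume.restrict (Icc (0 : ℝ) T)), HasDerivAt (primitive T f) (f t) t := by
  rw [ae_restrict_iff' measurableSet_Icc]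
  have hi := (integrable_indicator_iff measurableSet_Icc).2 hf
  filter_upwards [_root_.LocallyIntegrable.ae_hasDerivAt_integral hi.locallyIntegrable] with t ht hm
  have := ht 0
  rwa [indicator_of_mem hm] at this

lemma _root_.LipschitzWith.comp_absolutelyContinuousOnInterval {X Y : Type*}
    [PseudoMetricSpace X] [PseudoMetricSpace Y] {g : X → Y} {K : NNReal} {f : ℝ → X} {a b : ℝ}
    (hg : LipschitzWith K g) (hf : AbsolutelyContinuousOnInterval f a b) :
    AbsolutelyContinuousOnInterval (fun t => g (f t)) a b := by
  unfold AbsolutelyContinuousOnInterval at hf ⊢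
  refine squeeze_zero (fun _ => Finset.sum_nonneg fun _ _ => dist_nonneg) (fun E => ?_)
    (by simpa using hf.const_mul (K : ℝ))
  rw [Finset.mul_sum]
  exact Finset.sum_le_sum fun i _ => hg.dist_le_mul _ _

lemma absolutelyContinuousOnInterval_primitive (hf : IntegrableOn f (Icc 0 T)) :
    AbsolutelyContinuousOnInterval (primitive T f) 0 T :=
  ((integrable_indicator_iff measurableSet_Icc).2 hf).intervalIntegrable
    |>.absolutelyContinuousOnInterval_intervalIntegral (by simp)

lemma lipschitzWith_rot {q : ℍ[ℝ]} (hs : star q = -q) (hq : q * q = -1) :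
    LipschitzWith 1 (rot q) := by
  refine lipschitzWith_of_nnnorm_deriv_le (fun x => (hasDerivAt_rot hq x).differentiableAt)
    fun x => ?_
  rw [(hasDerivAt_rot hq x).deriv, ← NNReal.coe_le_coe, coe_nnnorm, norm_mul, norm_rot hs hq,
    mul_one, NNReal.coe_one]
  have : star q * q = 1 := by rw [hs, neg_mul, hq, neg_neg]
  exact (norm_eq_one_of_star_mul_self this).le

lemma hasDerivAt_exp_neg_I (x : ℝ) :
    HasDerivAt (fun x : ℝ => Complex.exp (-(Complex.I * x)))
      (-Complex.I * Complex.exp (-(Complex.I * x))) x := by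
  have h : HasDerivAt (fun x : ℝ => -(Complex.I * (x : ℂ))) (-Complex.I) x := by
    simpa using! ((hasDerivAt_id x).ofReal_comp.const_mul Complex.I).neg
  refine h.cexp.congr_deriv ?_
  ring

lemma norm_exp_neg_I (x : ℝ) : ‖Complex.exp (-(Complex.I * x))‖ = 1 := by
  rw [← mul_neg, mul_comm, ← Complex.ofReal_neg, Complex.norm_exp_ofReal_mul_I]

lemma lipschitzWith_exp_neg_I : LipschitzWith 1 fun x : ℝ => Complex.exp (-(Complex.I * x)) := by
  refine lipschitzWith_of_nnnorm_deriv_le (fun x => (hasDerivAt_exp_neg_I x).differentiableAt)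
    fun x => ?_
  rw [(hasDerivAt_exp_neg_I x).deriv, ← NNReal.coe_le_coe, coe_nnnorm, norm_mul, norm_exp_neg_I]
  simp

/-- The matrix entries of a quaternion as continuous linear functionals. -/
noncomputable def entryCLM (i j : Fin 2) : ℍ[ℝ] →L[ℝ] ℂ :=
  LinearMap.toContinuousLinearMap
    { toFun := fun x => toMat x i j
      map_add' := fun x y => by rw [map_add]; rfl
      map_smul' := fun r x => by rw [map_smul]; rfl }

lemma entryCLM_apply (i j : Fin 2) (x : ℍ[ℝ]) : entryCLM i j x = toMat x i j := rfl

/-- The solution of the Schrödinger equation built from a flow in the interaction picture. -/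
noncomputable def evolution (H₀ V : Mat) (T : ℝ) (f : ℝ → ℝ) (s : ℝ → ℍ[ℝ]) (t : ℝ) : Mat :=
  Complex.exp (-(Complex.I * phase H₀ V T f t)) •
    toMat (rot (direction V) (angle H₀ V T f t) * s t)

/-- Because `p` anticommutes with `q`, $e^{Fq}\,p\,e^{2Fq}=p\,e^{Fq}$, so $u=e^{Fq}s$ solves
$u'=(p+F'q)u$ where $F$ is differentiable, hence almost everywhere. Here $p+F'q$ is `axis H₀ + f t •
axis V`, and the scalar parts go into the phase. -/
theorem isEvolution (hH₀ : H₀.IsHermitian) (hV : V.IsHermitian) (hHV : ⁅H₀, V⁆ ≠ 0)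
    (hT : 0 < T) (hf : IntegrableOn f (Icc 0 T)) {s : ℝ → ℍ[ℝ]}
    (hs : IsFlow (drift H₀ V) (direction V) T (angle H₀ V T f) s) :
    IsEvolution H₀ V T f (evolution H₀ V T f s) := by
  have hpair := axisPair hH₀ hV hHV
  refine ⟨?_, fun i j => ?_, ?_⟩
  · simp [evolution, angle_zero, phase, primitive, rot_zero, hs.initial]
  · have hid : AbsolutelyContinuousOnInterval (fun t : ℝ => t) 0 T :=
      (LipschitzWith.id.lipschitzOnWith (s := uIcc 0 T)).absolutelyContinuousOnInterval
    have hprim := absolutelyContinuousOnInterval_primitive hf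
    have hphase : AbsolutelyContinuousOnInterval (phase H₀ V T f) 0 T :=
      (hid.const_mul _).fun_add (hprim.const_mul _)
    have hangle : AbsolutelyContinuousOnInterval (angle H₀ V T f) 0 T :=
      (hprim.fun_sub (hid.const_mul _)).const_mul _
    have hsac : AbsolutelyContinuousOnInterval s 0 T := by
      refine LipschitzOnWith.absolutelyContinuousOnInterval (K := ‖drift H₀ V‖₊) ?_
      rw [uIcc_of_le hT.le]
      refine LipschitzOnWith.of_dist_le_mul fun a ha b hb => ?_
      rw [dist_comm, dist_eq_norm, dist_comm, Real.dist_eq]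
      exact hs.norm_sub_le hpair ha hb
    have hu := ((lipschitzWith_rot hpair.star_right
      hpair.sq_right).comp_absolutelyContinuousOnInterval hangle).fun_smul hsac
    exact (lipschitzWith_exp_neg_I.comp_absolutelyContinuousOnInterval hphase).fun_smul
      ((entryCLM i j).lipschitz.comp_absolutelyContinuousOnInterval hu)
  · filter_upwards [ae_hasDerivAt_primitive hf, ae_restrict_mem measurableSet_Icc] with t ht hmt
    set q := direction V with hq
    set p := drift H₀ V with hp
    set u : ℝ → ℍ[ℝ] := fun t => rot q (angle H₀ V T f t) * s t with hu
    set φ' := H₀.trace.re / 2 + V.trace.re / 2 * f t with hφ'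
    set a' := ‖axis V‖ * (f t - specialControl H₀ V) with ha'
    have hphase : HasDerivAt (phase H₀ V T f) φ' t := by
      simpa using! ((hasDerivAt_id t).const_mul (H₀.trace.re / 2)).add (ht.const_mul (V.trace.re / 2))
    have hangle : HasDerivAt (angle H₀ V T f) a' t := by
      simpa using! (ht.sub ((hasDerivAt_id t).const_mul (specialControl H₀ V))).const_mul ‖axis V‖
    have hud : HasDerivAt u ((p + a' • q) * u t) t := by
      refine ((HasDerivAt.scomp t (hasDerivAt_rot hpair.sq_right _) hangle).mul
        (hs.hasDerivAt t hmt)).congr_deriv ?_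
      have : rot q (angle H₀ V T f t) * (p * rot q (2 * angle H₀ V T f t))
          = p * rot q (angle H₀ V T f t) := by
        rw [← mul_assoc, mul_rot hpair.anticomm, mul_assoc, ← rot_add hpair.sq_right]
        ring_nf
      rw [Function.comp_apply, ← mul_assoc (rot q _), this]
      simp only [hu, add_mul, smul_mul_assoc, mul_assoc]
      rw [add_comm]
    set c := Complex.exp (-(Complex.I * phase H₀ V T f t)) with hc
    have hcd : HasDerivAt (fun t => Complex.exp (-(Complex.I * phase H₀ V T f t)))
        (φ' • (-Complex.I * c)) t :=
      HasDerivAt.scomp t (hasDerivAt_exp_neg_I _) hphase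
    refine ⟨(φ' • (-Complex.I * c)) • toMat (u t) + c • toMat ((p + a' • q) * u t),
      fun i j => ?_, ?_⟩
    · refine (hcd.mul ((entryCLM i j).hasFDerivAt.comp_hasDerivAt t hud)).congr_deriv ?_
      simp only [entryCLM_apply, Matrix.add_apply, Matrix.smul_apply, smul_eq_mul, Function.comp, hc]
    · have hax : p + a' • q = axis H₀ + f t • axis V := by
        have hn : ‖axis V‖ ≠ 0 := norm_ne_zero_iff.2 (axis_ne_zero hH₀ hV hHV)
        rw [hp, hq, drift, direction, ha', smul_smul, mul_right_comm, mul_inv_cancel₀ hn, one_mul]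
        module
      have hK : H₀ + f t • V = φ' • (1 : Mat) + Complex.I • toMat (p + a' • q) := by
        rw [hax]
        conv_lhs => rw [eq_trace_add_axis hH₀, eq_trace_add_axis hV]
        rw [map_add, map_smul, smul_add, smul_add, smul_comm (f t) Complex.I, hφ']
        module
      rw [hK, map_mul toMat (p + a' • q)]
      change _ = _ * (c • toMat (u t))
      have hI := Complex.I_mul_I
      rw [add_mul, smul_mul_assoc, one_mul, smul_mul_assoc, mul_smul_comm, smul_add, smul_smul,
        smul_smul, ← Complex.coe_smul φ' (c • _), smul_smul]
      congr 2
      rw [Complex.real_smul]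
      linear_combination (-(φ' : ℂ) * c) * hI

/-! ### The objective functional -/

/-- The entries of $U_1^\dagger U_2$ are absolutely continuous, with derivative zero almost
everywhere because the Hamiltonian is Hermitian; so they keep their initial values. This gives
unitarity and uniqueness together. -/
lemma IsEvolution.conjTranspose_mul_eq_one (hH₀ : H₀.IsHermitian) (hV : V.IsHermitian)
    (hT : 0 < T) {U₁ U₂ : ℝ → Mat} (h₁ : IsEvolution H₀ V T f U₁)
    (h₂ : IsEvolution H₀ V T f U₂) : (U₁ T)ᴴ * U₂ T = 1 := by
  ext i j
  have hstar : LipschitzWith 1 (fun z : ℂ => star z) :=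
    LipschitzWith.of_dist_le_mul fun x y => by
      rw [dist_eq_norm, ← star_sub, Complex.star_def, Complex.norm_conj, ← dist_eq_norm]; simp
  have hac : AbsolutelyContinuousOnInterval (fun t => ∑ k, star (U₁ t k i) * U₂ t k j) 0 T := by
    simp only [Fin.sum_univ_two]
    exact ((hstar.comp_absolutelyContinuousOnInterval (h₁.absCont 0 i)).fun_smul
      (h₂.absCont 0 j)).fun_add
      ((hstar.comp_absolutelyContinuousOnInterval (h₁.absCont 1 i)).fun_smul (h₂.absCont 1 j))
  have hd : ∀ᵐ t, t ∈ uIcc 0 T →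
      HasDerivAt (fun t => ∑ k, star (U₁ t k i) * U₂ t k j) 0 t := by
    have e₁ := h₁.equation
    have e₂ := h₂.equation
    rw [ae_restrict_iff' measurableSet_Icc] at e₁ e₂
    filter_upwards [e₁, e₂] with t a₁ a₂ ht
    rw [uIcc_of_le hT.le] at ht
    obtain ⟨D₁, hD₁, k₁⟩ := a₁ ht
    obtain ⟨D₂, hD₂, k₂⟩ := a₂ ht
    have hsum : HasDerivAt (fun t => ∑ k, star (U₁ t k i) * U₂ t k j)
        (∑ k, (star (D₁ k i) * U₂ t k j + star (U₁ t k i) * D₂ k j)) t :=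
      HasDerivAt.fun_sum fun k _ => (hD₁ k i).star.mul (hD₂ k j)
    refine hsum.congr_deriv ?_
    have hm : D₁ᴴ * U₂ t + (U₁ t)ᴴ * D₂ = 0 := by
      set K := H₀ + f t • V with hK
      have hKh : Kᴴ = K := by
        rw [hK, Matrix.conjTranspose_add, Matrix.conjTranspose_smul, hH₀.eq, hV.eq, star_trivial]
      have s₁ : D₁ = -Complex.I • (K * U₁ t) := by
        rw [← k₁, smul_smul]; simp
      have s₂ : D₂ = -Complex.I • (K * U₂ t) := by
        rw [← k₂, smul_smul]; simp
      rw [s₁, s₂, Matrix.conjTranspose_smul, Matrix.conjTranspose_mul, hKh, smul_mul_assoc,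
        mul_smul_comm, mul_assoc, ← add_smul]
      simp
    have := congrFun (congrFun hm i) j
    simpa [Matrix.mul_apply, Finset.sum_add_distrib] using this
  obtain ⟨C, hC⟩ := hac.const_of_ae_hasDerivAt_zero hd
  rw [uIcc_of_le hT.le] at hC
  have c0 := hC 0 ⟨le_rfl, hT.le⟩
  have cT := hC T ⟨hT.le, le_rfl⟩
  simp only [h₁.initial, h₂.initial] at c0
  have c0' : ((1 : Mat)ᴴ * (1 : Mat) : Mat) i j = C := by rw [Matrix.mul_apply]; exact c0
  have cT' : ((U₁ T)ᴴ * U₂ T : Mat) i j = C := by rw [Matrix.mul_apply]; exact cT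
  rw [cT', ← c0', Matrix.conjTranspose_one, mul_one]

lemma IsEvolution.unique (hH₀ : H₀.IsHermitian) (hV : V.IsHermitian)
    (hT : 0 < T) {U₁ U₂ : ℝ → Mat} (h₁ : IsEvolution H₀ V T f U₁)
    (h₂ : IsEvolution H₀ V T f U₂) : U₁ T = U₂ T := by
  have e₁ := h₁.conjTranspose_mul_eq_one hH₀ hV hT h₁
  have e₂ := h₁.conjTranspose_mul_eq_one hH₀ hV hT h₂
  have e₃ : U₁ T * (U₁ T)ᴴ = 1 := mul_eq_one_comm.1 e₁
  calc U₁ T = U₁ T * ((U₁ T)ᴴ * U₂ T) := by rw [e₂, mul_one]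
    _ = U₂ T := by rw [← mul_assoc, e₃, one_mul]

lemma Control.integrableOn (f : Control T) : IntegrableOn f (Icc 0 T) := L1.integrable_coeFn f

theorem objective_eq (hH₀ : H₀.IsHermitian) (hV : V.IsHermitian) (hHV : ⁅H₀, V⁆ ≠ 0)
    (hT : 0 < T) {γ : ℝ} {ω : ℍ[ℝ]} (hW : W = Complex.exp (Complex.I * γ) • toMat ω)
    (f : Control T) {s : ℝ → ℍ[ℝ]}
    (hs : IsFlow (drift H₀ V) (direction V) T (angle H₀ V T f) s) :
    objective H₀ V W T f
      = (star ω * (rot (direction V) (angle H₀ V T f T) * s T)).re ^ 2 := by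
  have hev := isEvolution hH₀ hV hHV hT (Control.integrableOn f) hs
  have hfin : finalEvolution H₀ V T f = evolution H₀ V T f s T :=
    (Classical.epsilon_spec (p := IsEvolution H₀ V T f) ⟨_, hev⟩).unique hH₀ hV hT hev
  have hnorm : ‖Complex.exp (Complex.I * γ)‖ = 1 := by
    rw [mul_comm, Complex.norm_exp_ofReal_mul_I]
  rw [objective, hfin, evolution, hW, Matrix.conjTranspose_smul, ← toMat_star,
    smul_mul_smul_comm, ← map_mul, Matrix.trace_smul, trace_toMat, smul_eq_mul, norm_mul, norm_mul,
    Complex.star_def, Complex.norm_conj, hnorm, norm_exp_neg_I, norm_mul, Complex.norm_real, Real.norm_eq_abs, one_mul,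
    one_mul, mul_pow, sq_abs]
  norm_num

/-! ### Impulsive variations of a control -/

lemma primitive_congr {f g : ℝ → ℝ} (h : f =ᵐ[volume.restrict (Icc 0 T)] g) (t : ℝ) :
    primitive T f t = primitive T g t := by
  refine intervalIntegral.integral_congr_ae ?_
  rw [EventuallyEq, ae_restrict_iff' measurableSet_Icc] at h
  filter_upwards [h] with x hx _
  by_cases hm : x ∈ Icc 0 T
  · rw [indicator_of_mem hm, indicator_of_mem hm, hx hm]
  · rw [indicator_of_notMem hm, indicator_of_notMem hm]

lemma primitive_add {f g : ℝ → ℝ} (hf : IntegrableOn f (Icc 0 T)) (hg : IntegrableOn g (Icc 0 T))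
    (t : ℝ) : primitive T (f + g) t = primitive T f t + primitive T g t := by
  have hf' := (integrable_indicator_iff measurableSet_Icc).2 hf
  have hg' := (integrable_indicator_iff measurableSet_Icc).2 hg
  rw [primitive, indicator_add']
  exact intervalIntegral.integral_add hf'.intervalIntegrable hg'.intervalIntegrable

/-- The control equal to `c` on `[a, b]` and to zero elsewhere. -/
noncomputable def bump (T a b c : ℝ) : Control T :=
  indicatorConstLp 1 (measurableSet_Icc : MeasurableSet (Icc a b)) (measure_ne_top _ _) c

lemma primitive_bump {a b : ℝ} (c : ℝ) (t : ℝ) :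
    primitive T (bump T a b c) t = primitive T ((Icc a b).indicator fun _ => c) t :=
  primitive_congr indicatorConstLp_coeFn t

lemma primitive_bump_of_le {a b t : ℝ} (c : ℝ) (h0 : 0 ≤ t) (ht : t ≤ a) :
    primitive T (bump T a b c) t = 0 := by
  rw [primitive_bump, primitive]
  -- When `t = a` the intervals meet in the single point `a`, a null set.
  have hne : ∀ᵐ x : ℝ, x ≠ a := by simp [ae_iff, measure_singleton]
  rw [intervalIntegral.integral_congr_ae (g := fun _ => (0 : ℝ)), intervalIntegral.integral_zero]
  filter_upwards [hne] with x hx hxt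
  rw [uIoc_of_le h0] at hxt
  have : x ∉ Icc a b := fun hm => hx (le_antisymm (hxt.2.trans ht) hm.1)
  simp [indicator, this]

lemma primitive_bump_of_ge {a b t : ℝ} (c : ℝ) (ha : 0 < a) (hab : a ≤ b) (ht : b ≤ t)
    (htT : t ≤ T) : primitive T (bump T a b c) t = (b - a) * c := by
  rw [primitive_bump, primitive, intervalIntegral.integral_of_le (by linarith),
    setIntegral_congr_fun (g := (Icc a b).indicator fun _ => c) measurableSet_Ioc,
    setIntegral_indicator measurableSet_Icc, setIntegral_const,
    inter_eq_self_of_subset_right, Real.volume_real_Icc_of_le hab, smul_eq_mul]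
  · exact fun x hx => ⟨ha.trans_le hx.1, hx.2.trans ht⟩
  · exact fun x hx => indicator_of_mem (show x ∈ Icc 0 T from ⟨hx.1.le, hx.2.trans htT⟩) _

lemma norm_bump_le {a b : ℝ} (c : ℝ) (hab : a ≤ b) : ‖bump T a b c‖ ≤ |c| * (b - a) := by
  refine norm_indicatorConstLp_le.trans ?_
  rw [ENNReal.toReal_one, div_one, Real.rpow_one, Real.norm_eq_abs]
  gcongr
  rw [← Real.volume_real_Icc_of_le hab]
  exact ENNReal.toReal_mono (by simp) (Measure.restrict_apply_le _ _)

lemma angle_add_bump (f : Control T) (a₁ b₁ c₁ a₂ b₂ c₂ t : ℝ) :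
    angle H₀ V T (f + bump T a₁ b₁ c₁ + bump T a₂ b₂ c₂ : Control T) t = angle H₀ V T f t +
      ‖axis V‖ * (primitive T (bump T a₁ b₁ c₁) t + primitive T (bump T a₂ b₂ c₂) t) := by
  have h : primitive T (f + bump T a₁ b₁ c₁ + bump T a₂ b₂ c₂ : Control T) t
      = primitive T f t + primitive T (bump T a₁ b₁ c₁) t + primitive T (bump T a₂ b₂ c₂) t := by
    rw [primitive_congr (Lp.coeFn_add _ _), primitive_add (Control.integrableOn _)
      (Control.integrableOn _), primitive_congr (Lp.coeFn_add _ _),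
      primitive_add (Control.integrableOn _) (Control.integrableOn _)]
  rw [angle, h, angle]
  ring

/-- The $L^1$ norm of the bump realising an impulse of strength `ε` is at most `|ε| / ‖axis V‖`,
independently of its width `η`. So one `δ` serves all widths, which is what the passage to ideal
impulses needs. -/
theorem exists_impulseMaximal (hH₀ : H₀.IsHermitian) (hV : V.IsHermitian) (hHV : ⁅H₀, V⁆ ≠ 0)
    (hT : 0 < T) {γ : ℝ} {ω : ℍ[ℝ]} (hW : W = Complex.exp (Complex.I * γ) • toMat ω)
    (f : Control T) {s : ℝ → ℍ[ℝ]}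
    (hs : IsFlow (drift H₀ V) (direction V) T (angle H₀ V T f) s)
    (hmax : IsLocalMax (objective H₀ V W T) f) :
    ∃ δ > 0, ImpulseMaximal (drift H₀ V) (direction V) ω T (angle H₀ V T f) s δ := by
  have hpair := axisPair hH₀ hV hHV
  have hv : 0 < ‖axis V‖ := norm_pos_iff.2 (axis_ne_zero hH₀ hV hHV)
  obtain ⟨r, hr, hball⟩ := Metric.eventually_nhds_iff_ball.1 hmax
  refine ⟨r * ‖axis V‖, by positivity, fun τ₁ τ₂ ε₁ ε₂ h₁ h₁₂ h₂ hε η hη hη₁ hη₂ => ?_⟩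
  set c : ℝ → ℝ := fun ε => ε / (‖axis V‖ * η) with hc
  set g : Control T := f + bump T τ₁ (τ₁ + η) (c ε₁) + bump T τ₂ (τ₂ + η) (c ε₂) with hg
  have hcη : ∀ ε, ‖axis V‖ * (η * c ε) = ε := fun ε => by
    simp only [hc]; field_simp
  have hnorm : ∀ τ ε, ‖bump T τ (τ + η) (c ε)‖ ≤ |ε| / ‖axis V‖ := fun τ ε => by
    refine (norm_bump_le _ (by linarith)).trans_eq ?_
    rw [hc, abs_div, abs_of_pos (show 0 < ‖axis V‖ * η by positivity)]
    field_simp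
    ring
  have hgball : g ∈ Metric.ball f r := by
    rw [mem_ball_iff_norm, hg, add_assoc, add_sub_cancel_left]
    refine (norm_add_le _ _).trans_lt ((add_le_add (hnorm _ _) (hnorm _ _)).trans_lt ?_)
    rwa [← add_div, div_lt_iff₀ hv]
  obtain ⟨σ, hσ⟩ := exists_isFlow hpair hT.le
    (continuous_angle (H₀ := H₀) (V := V) (Control.integrableOn g))
  have hangle : ∀ t, angle H₀ V T g t = _ := angle_add_bump f _ _ _ _ _ _
  refine ⟨angle H₀ V T g, σ, hσ, fun t ht => ?_, fun t ht => ?_, fun t ht => ?_, ?_⟩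
  · rw [hangle, primitive_bump_of_le _ ht.1 ht.2,
      primitive_bump_of_le _ ht.1 (ht.2.trans h₁₂.le)]
    simp
  · rw [hangle, primitive_bump_of_ge _ h₁ (by linarith) ht.1 (by linarith [ht.2]),
      primitive_bump_of_le _ (by linarith [ht.1]) ht.2, add_sub_cancel_left, add_zero, hcη]
  · rw [hangle, primitive_bump_of_ge _ h₁ (by linarith) (by linarith [ht.1]) ht.2,
      primitive_bump_of_ge _ (by linarith) (by linarith) ht.1 ht.2, add_sub_cancel_left,
      add_sub_cancel_left, mul_add, hcη, hcη]
  · have := hball g hgball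
    rw [objective_eq hH₀ hV hHV hT hW f hs, objective_eq hH₀ hV hHV hT hW g hσ] at this
    exact sq_le_sq.1 this

theorem objective_le_one (hH₀ : H₀.IsHermitian) (hV : V.IsHermitian) (hHV : ⁅H₀, V⁆ ≠ 0)
    (hT : 0 < T) {γ : ℝ} {ω : ℍ[ℝ]} (hω : ‖ω‖ = 1)
    (hW : W = Complex.exp (Complex.I * γ) • toMat ω) (f : Control T) :
    objective H₀ V W T f ≤ 1 := by
  have hpair := axisPair hH₀ hV hHV
  obtain ⟨s, hs⟩ := exists_isFlow hpair hT.le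
    (continuous_angle (H₀ := H₀) (V := V) (Control.integrableOn f))
  rw [objective_eq hH₀ hV hHV hT hW f hs, sq_le_one_iff_abs_le_one]
  exact (abs_re_le_norm _).trans_eq (norm_overlap hpair hs hT.le hω)

/-- All maxima are global unless the target commutes with the special Hamiltonian and the
second-order conditions at the special control hold. -/
theorem allMaximaGlobal_of_not (hH₀ : H₀.IsHermitian) (hV : V.IsHermitian) (hHV : ⁅H₀, V⁆ ≠ 0)
    (hT : 0 < T) {γ : ℝ} {ω : ℍ[ℝ]} (hω : ‖ω‖ = 1)
    (hW : W = Complex.exp (Complex.I * γ) • toMat ω)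
    (h : ¬ (ω * drift H₀ V = drift H₀ V * ω ∧
      ∀ a, ω = rot (‖drift H₀ V‖⁻¹ • drift H₀ V) (-a) →
        Real.sin (a + ‖drift H₀ V‖ * T) ≠ 0 ∧ ∀ x ∈ Ioo 0 (‖drift H₀ V‖ * T),
          |Real.cos (a + ‖drift H₀ V‖ * T - 2 * x)| ≤ |Real.cos (a + ‖drift H₀ V‖ * T)|)) :
    AllMaximaGlobal H₀ V W T := by
  intro f hf
  have hpair := axisPair hH₀ hV hHV
  have hcont := continuous_angle (H₀ := H₀) (V := V) (Control.integrableOn f)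
  obtain ⟨s, hs⟩ := exists_isFlow hpair hT.le hcont
  obtain ⟨δ, hδ, hmax⟩ := exists_impulseMaximal hH₀ hV hHV hT hW f hs hf
  have h1 : objective H₀ V W T f = 1 := by
    by_contra hne
    refine h (hmax.commute_and_cos_le hpair hT hcont angle_zero hs hω hδ fun h1 => hne ?_)
    rw [objective_eq hH₀ hV hHV hT hW f hs, ← sq_abs, h1, one_pow]
  exact ⟨fun g => h1 ▸ objective_le_one hH₀ hV hHV hT hω hW g, h1⟩

/-! ### Gates that commute with the special Hamiltonian -/

lemma exp_neg_smul {p : ℍ[ℝ]} (hp : star p = -p) (hp0 : p ≠ 0) (α : ℝ) :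
    NormedSpace.exp (-α • p) = rot (‖p‖⁻¹ • p) (-(α * ‖p‖)) := by
  have hre : (-α • p).re = 0 := by
    rw [Quaternion.re_smul, re_eq_zero_of_star hp, smul_zero]
  have hn : ‖p‖ ≠ 0 := norm_ne_zero_iff.2 hp0
  rw [Quaternion.exp_of_re_eq_zero _ hre, rot, norm_smul, Real.norm_eq_abs, abs_neg]
  congr 1
  · rw [Real.cos_neg, ← Real.cos_abs (α * ‖p‖), abs_mul, abs_norm]
    ext <;> simp
  · rw [smul_smul, smul_smul]
    congr 1
    -- The quaternion exponential is expressed through $|\alpha|\,\|p\|$; oddness of the sine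
    -- restores the sign of `α`.
    rcases eq_or_ne α 0 with rfl | hα
    · simp
    · rcases abs_cases α with ⟨h, _⟩ | ⟨h, _⟩ <;> rw [h] <;> simp only [Real.sin_neg, neg_mul] <;>
        field_simp

lemma exp_toMat (x : ℍ[ℝ]) : NormedSpace.exp (toMat x) = toMat (NormedSpace.exp x) := by
  have hc : Continuous toMat := by
    refine continuous_matrix fun i j => ?_
    exact (entryCLM i j).continuous
  have hs := (NormedSpace.exp_series_hasSum_exp' (𝕂 := ℝ) x).map toMat hc
  rw [NormedSpace.exp_eq_tsum ℝ, ← hs.tsum_eq]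
  refine tsum_congr fun n => ?_
  rw [Function.comp_apply, map_smul, map_pow]

/-- The scalar part of the exponent splits off as a phase, and $i\alpha\cdot i=-\alpha$ turns the
rest into a rotation by the negative angle $-\alpha d$. -/
lemma specialGate_eq (hH₀ : H₀.IsHermitian) (hV : V.IsHermitian) (hHV : ⁅H₀, V⁆ ≠ 0) (α β : ℝ) :
    specialGate H₀ V α β = Complex.exp (Complex.I * (α * specialMean H₀ V + β : ℝ)) •
      toMat (rot (‖drift H₀ V‖⁻¹ • drift H₀ V) (-(α * specialNorm H₀ V))) := by
  have hpair := axisPair hH₀ hV hHV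
  rw [specialNorm_eq hH₀ hV, ← exp_neg_smul hpair.star_left hpair.left_ne_zero, specialGate,
    specialHamiltonian_eq hH₀ hV]
  set z : ℂ := Complex.I * (α * specialMean H₀ V + β : ℝ) with hz
  have e : (Complex.I * α) • (specialMean H₀ V • (1 : Mat) + Complex.I • toMat (drift H₀ V))
      + (Complex.I * β) • (1 : Mat) = algebraMap ℂ Mat z + toMat (-α • drift H₀ V) := by
    rw [map_smul, Algebra.algebraMap_eq_smul_one, hz]
    have hI := Complex.I_mul_I
    ext i j
    simp only [Matrix.add_apply, Matrix.smul_apply, smul_eq_mul, Complex.real_smul]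
    push_cast
    linear_combination (α * toMat (drift H₀ V) i j) * hI
  rw [e, Matrix.exp_add_of_commute _ _ (Algebra.commute_algebraMap_left z _), exp_toMat,
    Algebra.algebraMap_eq_smul_one, Matrix.smul_one_eq_diagonal, Matrix.exp_diagonal]
  have : NormedSpace.exp (fun _ : Fin 2 => z) = fun _ => Complex.exp z := by
    rw [Pi.exp_def, Complex.exp_eq_exp_ℂ]
  rw [this, ← Matrix.smul_one_eq_diagonal, smul_mul_assoc, one_mul]

lemma exists_eq_rot_of_commute {p ω : ℍ[ℝ]} (hp : star p = -p)
    (hnn : (‖p‖⁻¹ • p) * (‖p‖⁻¹ • p) = -1) (hω : ‖ω‖ = 1) (h : ω * p = p * ω) :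
    ∃ φ : ℝ, ω = rot (‖p‖⁻¹ • p) φ := by
  set n := ‖p‖⁻¹ • p with hn
  have hns : star n = -n := star_normalized hp
  have hωn : ω * n = n * ω := by rw [hn, mul_smul_comm, smul_mul_assoc, h]
  have hw : ω.im * n = n * ω.im := by
    have h1 := hωn
    rw [← Quaternion.re_add_im ω, add_mul, mul_add, Quaternion.coe_commutes] at h1
    exact add_left_cancel h1
  -- Commuting imaginary quaternions have a self-conjugate, hence real, product. So `ω.im` is a
  -- multiple of `n`, and the angle is the argument of the complex number `ω.re + k i`.
  have hreal : ω.im * n = ((ω.im * n).re : ℍ[ℝ]) := by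
    refine Quaternion.star_eq_self.1 ?_
    rw [star_mul, hns, Quaternion.star_im, neg_mul_neg, hw]
  set k := -(ω.im * n).re with hk
  have him : ω.im = k • n := by
    have h1 : ω.im * n * n = ((ω.im * n).re : ℍ[ℝ]) * n := congrArg (· * n) hreal
    rw [mul_assoc, hnn, mul_neg_one, Quaternion.coe_mul_eq_smul] at h1
    rw [hk, neg_smul, ← h1, neg_neg]
  have hωe : ω = ω.re • (1 : ℍ[ℝ]) + k • n := by
    conv_lhs => rw [← Quaternion.re_add_im ω, him]
    congr 1
    ext <;> simp
  have hsq : ω.re ^ 2 + k ^ 2 = 1 := by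
    have h1 := star_mul_self_of_norm hω
    rw [hωe, star_add, Quaternion.star_smul, Quaternion.star_smul, hns, star_one] at h1
    have h2 : (ω.re ^ 2 + k ^ 2) • (1 : ℍ[ℝ]) = 1 := by
      refine Eq.trans ?_ h1
      simp only [add_mul, mul_add, smul_mul_smul_comm, one_mul, mul_one, smul_neg, neg_mul,
        hnn, smul_neg]
      module
    have h3 := congrArg (fun x : ℍ[ℝ] => x.re) h2
    simpa using h3
  have hz : ‖(⟨ω.re, k⟩ : ℂ)‖ = 1 := by
    rw [Complex.norm_def, Complex.normSq_mk, ← sq, ← sq, hsq, Real.sqrt_one]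
  refine ⟨(⟨ω.re, k⟩ : ℂ).arg, ?_⟩
  have hz0 : (⟨ω.re, k⟩ : ℂ) ≠ 0 := by rw [← norm_ne_zero_iff, hz]; exact one_ne_zero
  rw [rot, Complex.cos_arg hz0, Complex.sin_arg, hz, div_one, div_one]
  exact hωe

lemma commute_toMat_iff (hH₀ : H₀.IsHermitian) (hV : V.IsHermitian) {γ : ℝ} {ω : ℍ[ℝ]} :
    ⁅specialHamiltonian H₀ V, Complex.exp (Complex.I * γ) • toMat ω⁆ = 0 ↔
      ω * drift H₀ V = drift H₀ V * ω := by
  have e : ⁅specialHamiltonian H₀ V, Complex.exp (Complex.I * γ) • toMat ω⁆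
      = (Complex.I * Complex.exp (Complex.I * γ)) •
        (toMat (drift H₀ V * ω) - toMat (ω * drift H₀ V)) := by
    rw [Ring.lie_def, specialHamiltonian_eq hH₀ hV, map_mul, map_mul]
    simp only [mul_add, add_mul, mul_one, one_mul, smul_mul_assoc, mul_smul_comm]
    module
  rw [e, smul_eq_zero_iff_right (mul_ne_zero Complex.I_ne_zero (Complex.exp_ne_zero _)),
    sub_eq_zero, toMat_injective.eq_iff, eq_comm]

lemma exists_specialGate_eq (hH₀ : H₀.IsHermitian) (hV : V.IsHermitian) (hHV : ⁅H₀, V⁆ ≠ 0)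
    (hW : W ∈ Matrix.unitaryGroup (Fin 2) ℂ) (h : ⁅specialHamiltonian H₀ V, W⁆ = 0) :
    ∃ α ∈ Ioc 0 (Real.pi / specialNorm H₀ V), ∃ β ∈ Ico 0 (2 * Real.pi),
      W = specialGate H₀ V α β := by
  have hpair := axisPair hH₀ hV hHV
  have hnn := hpair.normalized_mul_self
  obtain ⟨γ, ω, hω, rfl⟩ := exists_phase_smul_toMat hW
  rw [commute_toMat_iff hH₀ hV] at h
  obtain ⟨φ, hφ⟩ := exists_eq_rot_of_commute hpair.star_left hnn hω h
  set d := specialNorm H₀ V with hd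
  have hd0 : 0 < d := by
    rw [hd, specialNorm_eq hH₀ hV]; exact norm_pos_iff.2 hpair.left_ne_zero
  -- The angle is reduced modulo $\pi$ only: the resulting sign $(-1)^m$ is a phase and is absorbed
  -- in $\beta$, which is then reduced modulo $2\pi$.
  set ψ := toIocMod Real.pi_pos 0 (-φ) with hψ
  set m := toIocDiv Real.pi_pos 0 (-φ) with hm
  have hψm : ψ = -φ - m * Real.pi := by
    rw [hψ, toIocMod, zsmul_eq_mul]
  have hψmem := toIocMod_mem_Ioc Real.pi_pos 0 (-φ)
  rw [zero_add] at hψmem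
  set β₀ := γ - m * Real.pi - ψ / d * specialMean H₀ V with hβ₀
  refine ⟨ψ / d, ⟨div_pos hψmem.1 hd0, div_le_div_of_nonneg_right hψmem.2 hd0.le⟩,
    toIcoMod Real.two_pi_pos 0 β₀, ?_, ?_⟩
  · simpa using toIcoMod_mem_Ico Real.two_pi_pos 0 β₀
  · rw [specialGate_eq hH₀ hV hHV, ← hd, div_mul_cancel₀ _ hd0.ne', hφ]
    set n := ‖drift H₀ V‖⁻¹ • drift H₀ V
    have hrot : rot n φ = Real.cos (m * Real.pi) • rot n (-ψ) := by
      rw [show φ = -(m * Real.pi) + -ψ by rw [hψm]; ring, rot_add hnn]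
      conv_lhs => rw [rot, Real.sin_neg, Real.sin_int_mul_pi, Real.cos_neg]
      rw [neg_zero, zero_smul, add_zero, smul_mul_assoc, one_mul]
    have hexp : Complex.exp (Complex.I * γ) * (Real.cos (m * Real.pi) : ℝ)
        = Complex.exp (Complex.I * (ψ / d * specialMean H₀ V
          + toIcoMod Real.two_pi_pos 0 β₀ : ℝ)) := by
      have h1 : toIcoMod Real.two_pi_pos 0 β₀
          = β₀ - toIcoDiv Real.two_pi_pos 0 β₀ * (2 * Real.pi) := by
        rw [toIcoMod, zsmul_eq_mul]
      have h2 : ((Real.cos (m * Real.pi) : ℝ) : ℂ)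
          = Complex.exp (((-(m * Real.pi) : ℝ) : ℂ) * Complex.I) := by
        rw [Complex.exp_mul_I, ← Complex.ofReal_cos, ← Complex.ofReal_sin, Real.sin_neg,
          Real.cos_neg, Real.sin_int_mul_pi]
        simp
      rw [h2, ← Complex.exp_add, h1, hβ₀]
      set j := toIcoDiv Real.two_pi_pos 0 (γ - m * Real.pi - ψ / d * specialMean H₀ V)
      rw [Complex.exp_eq_exp_iff_exists_int]
      refine ⟨j, ?_⟩
      push_cast
      ring
    rw [hrot, map_smul, ← Complex.coe_smul, smul_smul, hexp]

/-- Here the target is the rotation by $-\alpha d$, so $a=\alpha d$ and $\theta=(\alpha+T)d$;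
`exists_cos_sq_lt` supplies a pair of impulses that violates the second-order condition. -/
theorem allMaximaGlobal_of_specialGate (hH₀ : H₀.IsHermitian) (hV : V.IsHermitian)
    (hHV : ⁅H₀, V⁆ ≠ 0) {α β T : ℝ} (hT : 0 < T) (hα : 0 < α)
    (hαπ : α * specialNorm H₀ V ≤ Real.pi)
    (h : α * specialNorm H₀ V < Real.pi / 2 ∨ Real.pi < (α + T) * specialNorm H₀ V) :
    AllMaximaGlobal H₀ V (specialGate H₀ V α β) T := by
  have hpair := axisPair hH₀ hV hHV
  have hnn := hpair.normalized_mul_self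
  have hd0 : 0 < ‖drift H₀ V‖ := norm_pos_iff.2 hpair.left_ne_zero
  refine allMaximaGlobal_of_not hH₀ hV hHV hT
    (norm_rot (star_normalized hpair.star_left) hnn _) (specialGate_eq hH₀ hV hHV α β) ?_
  rintro ⟨-, hneg⟩
  obtain ⟨hsin, hcos⟩ := hneg _ rfl
  rw [specialNorm_eq hH₀ hV] at *
  obtain ⟨x, hx, hlt⟩ := exists_cos_sq_lt (mul_pos hd0 hT) rfl hsin (mul_pos hα hd0) hαπ
    (h.imp_right fun h => by linarith)
  exact (hcos x hx).not_gt hlt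

end Qubit

theorem theorem2 (H₀ V W : Matrix (Fin 2) (Fin 2) ℂ)
    (hH₀ : H₀.IsHermitian) (hV : V.IsHermitian) (hHV : ⁅H₀, V⁆ ≠ 0)
    (hW : W ∈ Matrix.unitaryGroup (Fin 2) ℂ) :
    (⁅Qubit.specialHamiltonian H₀ V, W⁆ ≠ 0 →
      ∀ T : ℝ, 0 < T → Qubit.AllMaximaGlobal H₀ V W T) ∧
    (⁅Qubit.specialHamiltonian H₀ V, W⁆ = 0 →
      (∃ α ∈ Set.Ioc 0 (Real.pi / Qubit.specialNorm H₀ V),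
        ∃ β ∈ Set.Ico 0 (2 * Real.pi), W = Qubit.specialGate H₀ V α β) ∧
      ∀ α β : ℝ, W = Qubit.specialGate H₀ V α β →
        (α ∈ Set.Ioo 0 (Real.pi / (2 * Qubit.specialNorm H₀ V)) →
          ∀ T : ℝ, 0 < T → Qubit.AllMaximaGlobal H₀ V W T) ∧
        (α ∈ Set.Icc (Real.pi / (2 * Qubit.specialNorm H₀ V))
            (Real.pi / Qubit.specialNorm H₀ V) →
          ∀ T : ℝ, Real.pi / Qubit.specialNorm H₀ V - α < T →
            Qubit.AllMaximaGlobal H₀ V W T)) := by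
  have hd0 : 0 < Qubit.specialNorm H₀ V := by
    rw [Qubit.specialNorm_eq hH₀ hV]
    exact norm_pos_iff.2 (Qubit.axisPair hH₀ hV hHV).left_ne_zero
  have hπ := Real.pi_pos
  refine ⟨fun hne T hT => ?_, fun h0 => ⟨Qubit.exists_specialGate_eq hH₀ hV hHV hW h0, ?_⟩⟩
  · obtain ⟨γ, ω, hω, rfl⟩ := Qubit.exists_phase_smul_toMat hW
    exact Qubit.allMaximaGlobal_of_not hH₀ hV hHV hT hω rfl fun h =>
      hne ((Qubit.commute_toMat_iff hH₀ hV).2 h.1)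
  · rintro α β rfl
    refine ⟨fun hα T hT => ?_, fun hα T hT => ?_⟩
    · have h1 := hα.2
      rw [lt_div_iff₀ (by positivity)] at h1
      exact Qubit.allMaximaGlobal_of_specialGate hH₀ hV hHV hT hα.1 (by linarith)
        (Or.inl (by linarith))
    · have h1 : 0 < α := lt_of_lt_of_le (by positivity) hα.1
      have h2 := hα.2
      have hT0 : 0 < T := by linarith
      have h3 : Real.pi / Qubit.specialNorm H₀ V < α + T := by linarith
      rw [le_div_iff₀ hd0] at h2
      rw [div_lt_iff₀ hd0] at h3
      exact Qubit.allMaximaGlobal_of_specialGate hH₀ hV hHV hT0 h1 h2 (Or.inr h3)
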